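/- Let $(\Omega,\mathcal F,m)$ be a probability space and $\rho>0$. Let $f:\mathbb R\to(-\infty,+\infty]$ be convex, lower semicontinuous, $+\infty$ on $(-\infty,0)$ and finite in a neighbourhood of $1$, and put $\operatorname{dom} f=\{f<\infty\}$ and $f^*(\xi)=\sup_x[x\xi-f(x)]$. Let $$B_\rho(m)=\Big\{\tilde m \text{ probability measure}:\ \tilde m\ll m,\ \int f\Big(\tfrac{d\tilde m}{dm}\Big)dm-f(1)\le\rho\Big\}.$$ Consider players $i\in\mathcal J$ with action sets $\mathcal A_i$ and real losses $l_i(a,\omega)$. Fix a player $j$ and the actions $a_{-j}$ of the others, and suppose that $l_j(a,\cdot)\in L^1(m)$ for every $a=(a_j,a_{-j})$ with $a_j\in\mathcal A_j$. Consider $$(P_j)\quad \inf_{a_j\in\mathcal A_j}\ \sup_{\tilde m\in B_\rho(m)}\mathbb E_{\tilde m}\,l_j(a,\cdot),$$ $$(P_j^*)\quad \inf_{a_j\in\mathcal A_j,\ \lambda\ge0,\ \mu\in\mathbb R} l_j^*(a,\lambda,\mu),\qquad l_j^*(a,\lambda,\mu)=\lambda(\rho+f(1))+\mu+\mathbb E_m\Big[\lambda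 f^*\Big(\frac{l_j(a,\cdot)-\mu}{\lambda}\Big)\Big],$$ where for $\lambda=0$ the term $\lambda f^*(y/\lambda)$ means $\sup_{x\in\operatorname{dom} f}xy$. Expectations are taken in $[-\infty,+\infty]$, as the difference of the expectations of the positive and negative parts, and equal $-\infty$ if both are infinite. Then: 1. $(P_j)$ and $(P_j^*)$ have the same value. 2. If $(a_j,\lambda^*,\mu^*)$ is a solution of $(P_j^*)$, then $a_j$ is an optimal action in $(P_j)$. 3. If moreover $\lambda^*>0$ and $l_j^*(a,\cdot,\cdot)<+\infty$ in a neighbourhood of $(\lambda^*,\mu^*)$, then there is a measurable $L^*:\Omega\to[0,\infty)$ with $\int L^*\,dm=1$ such that, with $\xi=(l_j(a,\cdot)-\mu^*)/\lambda^*$, for $m$-almost every $\omega$ the number $\xi(\omega)$ is a subgradient of $f$ at $L^*(\omega)$, and $$f'(L^*(\omega))=\frac{l_j(a,\omega)-\mu^*}{\lambda^*}$$ whenever $L^*(\omega)$ is an interior point of $\operatorname{dom} f$ at which $f$ is differentiable. If $f$ is differentiable in the interior of $\operatorname{dom} f$ and $|f'|\to\infty$ at the boundary points of $\operatorname{dom}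 f$ (as for $f(x)=x\log x-x$), then $L^*(\omega)$ is interior and this equation holds for $m$-almost every $\omega$. Furthermore $a_j$ together with $d\tilde m^*=L^*dm$ solves $(P_j)$: $a_j$ is an optimal action, $\tilde m^*\in B_\rho(m)$, and $\tilde m^*$ attains $\sup_{\tilde m\in B_\rho(m)}\mathbb E_{\tilde m}l_j(a,\cdot)$. -/

import Mathlib

open MeasureTheory Set Filter Topology
open scoped ENNReal

namespace DRGame

noncomputable section

/-- Expectation of an extended real valued function: integral of the positive part minus integral
of the negative part. If both are infinite the value is `⊥`. -/
def expect {Ω : Type*} [MeasurableSpace Ω] (ν : Measure Ω) (g : Ω → EReal) : EReal :=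
  ((∫⁻ ω, (g ω).toENNReal ∂ν : ℝ≥0∞) : EReal) - ((∫⁻ ω, (-g ω).toENNReal ∂ν : ℝ≥0∞) : EReal)

/-- Effective domain of an extended real valued function on the line. -/
def effDom (f : ℝ → EReal) : Set ℝ := {x | f x < ⊤}

/-- A generator of a divergence: a proper closed convex function on `[0, ∞)`, extended by `⊤` to
the negative reals, and finite around `1`. -/
structure IsGenerator (f : ℝ → EReal) : Prop where
  neg : ∀ x < 0, f x = ⊤
  proper : ∀ x, f x ≠ ⊥
  convex : Convex ℝ {p : ℝ × ℝ | f p.1 ≤ (p.2 : EReal)}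
  lsc : LowerSemicontinuous f
  one_mem : (1 : ℝ) ∈ interior (effDom f)

/-- The derivative of `f` (meaningful at interior points of the effective domain). -/
def genDeriv (f : ℝ → EReal) (x : ℝ) : ℝ := deriv (fun y => (f y).toReal) x

/-- `ξ` is a subgradient of `f` at `x`. -/
def IsSubgradient (f : ℝ → EReal) (x ξ : ℝ) : Prop :=
  x ∈ effDom f ∧ ∀ y : ℝ, f x + (((y - x) * ξ : ℝ) : EReal) ≤ f y

/-- Essential smoothness: `f` is differentiable in the interior of its effective domain and its
derivative blows up at the boundary. -/
def EssentiallySmooth (f : ℝ → EReal) : Prop :=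
  (∀ x ∈ interior (effDom f), DifferentiableAt ℝ (fun y => (f y).toReal) x) ∧
  ∀ b ∈ frontier (effDom f),
    Tendsto (fun x => |genDeriv f x|) (𝓝[interior (effDom f)] b) atTop

/-- The Legendre-Fenchel transform of `f`. -/
def conj (f : ℝ → EReal) (ξ : ℝ) : EReal := ⨆ x : ℝ, (((x * ξ : ℝ) : EReal) - f x)

/-- `lam * f^*(y / lam)`, the supremum over `x` of `x * y - lam * f x`. For `lam = 0` this is the
support function of the effective domain of `f`. -/
def scaledConj (f : ℝ → EReal) (lam y : ℝ) : EReal :=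
  if lam = 0 then ⨆ x ∈ effDom f, ((x * y : ℝ) : EReal)
  else (lam : EReal) * conj f (y / lam)

variable {Ω : Type*} [MeasurableSpace Ω]

/-- The divergence generated by `f`, for `m'` absolutely continuous with respect to `m`. -/
def fDivergence (f : ℝ → EReal) (m' m : Measure Ω) : EReal :=
  expect m (fun ω => f (m'.rnDeriv m ω).toReal) - f 1

/-- The uncertainty set: probability measures, absolutely continuous with respect to `m`, whose
divergence from `m` is at most `ρ`. -/
def ball (f : ℝ → EReal) (m : Measure Ω) (ρ : ℝ) : Set (Measure Ω) :=
  {m' | IsProbabilityMeasure m' ∧ m' ≪ m ∧ fDivergence f m' m ≤ (ρ : EReal)}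

/-- Worst-case expected value over the uncertainty set of a loss `ℓ`. -/
def worstLoss (f : ℝ → EReal) (m : Measure Ω) (ρ : ℝ) (ℓ : Ω → ℝ) : EReal :=
  ⨆ m' ∈ ball f m ρ, expect m' (fun ω => (ℓ ω : EReal))

/-- The dual objective `lam * (ρ + f 1) + mu + E_m[lam * f^*((ℓ - mu) / lam)]`. -/
def dualLoss (f : ℝ → EReal) (m : Measure Ω) (ρ : ℝ) (ℓ : Ω → ℝ) (lam mu : ℝ) : EReal :=
  (lam : EReal) * ((ρ : EReal) + f 1) + (mu : EReal) +
    expect m (fun ω => scaledConj f lam (ℓ ω - mu))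

section Player

variable {J : Type*} [DecidableEq J] {E : J → Type*}

/-- Value of the robust best-response problem of player `j`, the actions of the other players
being those of the profile `a`. -/
def robustValue (f : ℝ → EReal) (m : Measure Ω) (ρ : ℝ) (A : ∀ i, Set (E i))
    (l : J → (∀ i, E i) → Ω → ℝ) (j : J) (a : ∀ i, E i) : EReal :=
  ⨅ x ∈ A j, worstLoss f m ρ (l j (Function.update a j x))

/-- Value of the finite-dimensional problem of player `j`. -/
def dualValue (f : ℝ → EReal) (m : Measure Ω) (ρ : ℝ) (A : ∀ i, Set (E i))
    (l : J → (∀ i, E i) → Ω → ℝ) (j : J) (a : ∀ i, E i) : EReal :=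
  ⨅ x ∈ A j, ⨅ lam : ℝ, ⨅ _ : 0 ≤ lam, ⨅ mu : ℝ,
    dualLoss f m ρ (l j (Function.update a j x)) lam mu

/-- `x` is an optimal action in the robust best-response problem of player `j`. -/
def IsRobustBestResponse (f : ℝ → EReal) (m : Measure Ω) (ρ : ℝ) (A : ∀ i, Set (E i))
    (l : J → (∀ i, E i) → Ω → ℝ) (j : J) (a : ∀ i, E i) (x : E j) : Prop :=
  x ∈ A j ∧ worstLoss f m ρ (l j (Function.update a j x)) = robustValue f m ρ A l j a

/-- The pair `(x, m')` solves the robust best-response problem of player `j`: `x` is optimal and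
`m'` is a worst-case measure of the uncertainty set against `x`. -/
def SolvesRobust (f : ℝ → EReal) (m : Measure Ω) (ρ : ℝ) (A : ∀ i, Set (E i))
    (l : J → (∀ i, E i) → Ω → ℝ) (j : J) (a : ∀ i, E i) (x : E j) (m' : Measure Ω) : Prop :=
  IsRobustBestResponse f m ρ A l j a x ∧ m' ∈ ball f m ρ ∧
    expect m' (fun ω => (l j (Function.update a j x) ω : EReal)) =
      worstLoss f m ρ (l j (Function.update a j x))

/-- The triple `(x, lam, mu)` solves the finite-dimensional problem of player `j`. -/
def SolvesDual (f : ℝ → EReal) (m : Measure Ω) (ρ : ℝ) (A : ∀ i, Set (E i))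
    (l : J → (∀ i, E i) → Ω → ℝ) (j : J) (a : ∀ i, E i) (x : E j) (lam mu : ℝ) : Prop :=
  x ∈ A j ∧ 0 ≤ lam ∧
    dualLoss f m ρ (l j (Function.update a j x)) lam mu = dualValue f m ρ A l j a

end Player

end

end DRGame

namespace DRGame

/-! ### Extended expectations -/

/-! For a fixed action this is Lagrange duality for maximizing `∫ L ℓ dm` over densities `L` with `∫
L dm = 1` and `∫ f(L) dm ≤ ρ + f 1`. Integrating Fenchel's inequality `L ℓ ≤ lam f(L) + mu L + lam
f^*((ℓ - mu) / lam)` gives weak duality (`expect_le_dualLoss`).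

For the converse it is enough to use simple densities, for which all integrals are finite. The
triples (mass defect, at least the divergence excess, at most the loss) form a convex set in `ℝ³`.
If `V` exceeds the worst-case loss, `(0, 0, V)` is not interior to this set and can be separated
from it. Slater's condition holds because `ρ > 0` and constants near `1` are available, so the
functional has a positive loss component, and normalizing it yields multipliers
(`exists_multipliers`). The resulting bound for all simple `L` passes to the pointwise supremum
under the expectation (`expect_scaledConj_le`), so the dual value is at most `V`. Taking infima over
actions gives equality of the two values, and weak duality then makes the action of a dual solution
optimal.

A worst-case density is a selection `L(ω)` of maximizers of `x ξ(ω) - f x` with mass `1` and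
divergence exactly `ρ`: Fenchel's inequality becomes an equality. Maximizers need not be unique,
since `f` need not be strictly convex. However, the smallest and the largest one differ for only
countably many slopes. A weight in `[0, 1]` at each of these slopes gives a family of selections
indexed by a compact cube, and the pairs `(∫ L, ∫ f(L))` fill a compact convex set in `ℝ²`. If it
missed `(1, ρ + f 1)`, a functional `(q, p)` would separate them. Moving `(lam, mu)` along `(p, q)`,
the maximizers converge to one of the mixed selections (`tendsto_selMin_ray`), and the limit of the
first-order condition (`perturbation_nonneg`) contradicts the separation (`exists_density`). -/

theorem expect_mono_ae {Ω : Type*} [MeasurableSpace Ω] {ν : Measure Ω} {g k : Ω → EReal}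
    (h : ∀ᵐ ω ∂ν, g ω ≤ k ω) : expect ν g ≤ expect ν k := by
  unfold expect
  refine EReal.sub_le_sub ?_ ?_
  · exact EReal.coe_ennreal_le_coe_ennreal_iff.2
      (lintegral_mono_ae (h.mono fun ω hω => EReal.toENNReal_le_toENNReal hω))
  · exact EReal.coe_ennreal_le_coe_ennreal_iff.2
      (lintegral_mono_ae (h.mono fun ω hω => EReal.toENNReal_le_toENNReal
        (EReal.neg_le_neg_iff.2 hω)))

theorem expect_congr_ae {Ω : Type*} [MeasurableSpace Ω] {ν : Measure Ω} {g k : Ω → EReal}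
    (h : g =ᵐ[ν] k) : expect ν g = expect ν k :=
  le_antisymm (expect_mono_ae h.le) (expect_mono_ae h.symm.le)

theorem expect_coe {Ω : Type*} [MeasurableSpace Ω] {ν : Measure Ω} {k : Ω → ℝ}
    (hk : Integrable k ν) : expect ν (fun ω => (k ω : EReal)) = ((∫ ω, k ω ∂ν : ℝ) : EReal) := by
  unfold expect
  simp only [← EReal.coe_neg, EReal.real_coe_toENNReal]
  have h1 : ∫⁻ ω, ENNReal.ofReal (k ω) ∂ν ≠ ⊤ := hk.lintegral_lt_top.ne
  have h2 : ∫⁻ ω, ENNReal.ofReal (-k ω) ∂ν ≠ ⊤ := hk.neg.lintegral_lt_top.ne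
  rw [integral_eq_lintegral_pos_part_sub_lintegral_neg_part hk, EReal.coe_sub,
    EReal.coe_ennreal_toReal h1, EReal.coe_ennreal_toReal h2]

/-- An extended real function with finite expectation from above and an integrable minorant is
a.e. equal to an integrable function. -/
theorem exists_integrable_of_expect_lt_top {Ω : Type*} [MeasurableSpace Ω] {ν : Measure Ω}
    {g : Ω → EReal} {k : Ω → ℝ} (hg : AEMeasurable g ν) (hk : Integrable k ν)
    (hkg : ∀ᵐ ω ∂ν, (k ω : EReal) ≤ g ω) (h : expect ν g < ⊤) :
    (∀ᵐ ω ∂ν, ((g ω).toReal : EReal) = g ω) ∧ Integrable (fun ω => (g ω).toReal) ν := by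
  have hneg : ∫⁻ ω, (-g ω).toENNReal ∂ν < ⊤ := by
    refine lt_of_le_of_lt (lintegral_mono_ae (hkg.mono fun ω hω => ?_)) hk.neg.lintegral_lt_top
    rw [Pi.neg_apply, ← EReal.real_coe_toENNReal, EReal.coe_neg]
    exact EReal.toENNReal_le_toENNReal (EReal.neg_le_neg_iff.2 hω)
  have hpos : ∫⁻ ω, (g ω).toENNReal ∂ν < ⊤ := by
    by_contra hc
    rw [not_lt, top_le_iff] at hc
    unfold expect at h
    rw [hc, ← ENNReal.coe_toNNReal hneg.ne] at h
    simp only [EReal.coe_ennreal_top] at h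
    exact absurd h (by
      rw [show (((∫⁻ ω, (-g ω).toENNReal ∂ν).toNNReal : ℝ≥0∞) : EReal) =
        (((∫⁻ ω, (-g ω).toENNReal ∂ν).toNNReal : ℝ) : EReal) from rfl, EReal.top_sub_coe]
      exact lt_irrefl _)
  have hne : ∀ᵐ ω ∂ν, ((g ω).toReal : EReal) = g ω := by
    filter_upwards [ae_lt_top' hg.ereal_toENNReal hpos.ne, hkg] with ω h1 h2
    refine EReal.coe_toReal (fun hc => ?_) (fun hc => ?_)
    · rw [hc] at h1; simp at h1
    · rw [hc] at h2; exact (EReal.bot_lt_coe _).not_ge h2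
  refine ⟨hne, ⟨hg.ereal_toReal.aestronglyMeasurable, ?_⟩⟩
  rw [HasFiniteIntegral]
  refine lt_of_le_of_lt (lintegral_mono_ae (g := fun ω => (g ω).toENNReal + (-g ω).toENNReal) ?_) ?_
  · filter_upwards [hne] with ω hω
    rw [← hω, ← EReal.coe_neg, EReal.real_coe_toENNReal, EReal.real_coe_toENNReal, EReal.toReal_coe,
      Real.enorm_eq_ofReal_abs]
    rcases le_total 0 (g ω).toReal with h0 | h0
    · rw [abs_of_nonneg h0]; exact le_self_add
    · rw [abs_of_nonpos h0]; exact le_add_self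
  · rw [lintegral_add_left' hg.ereal_toENNReal]
    exact ENNReal.add_lt_top.2 ⟨hpos, hneg⟩

theorem expect_eq_integral_toReal {Ω : Type*} [MeasurableSpace Ω] {ν : Measure Ω}
    {g : Ω → EReal} (h : ∀ᵐ ω ∂ν, ((g ω).toReal : EReal) = g ω)
    (hi : Integrable (fun ω => (g ω).toReal) ν) :
    expect ν g = ((∫ ω, (g ω).toReal ∂ν : ℝ) : EReal) := by
  rw [← expect_coe hi]
  exact expect_congr_ae (h.mono fun ω hω => hω.symm)

/-- The change of density holds for lower integrals because `d` is a.e. finite, so `k` needs neither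
measurability nor integrability. This matters because a loss in `L¹(m)` may fail to be integrable
under a measure of the ball. -/
theorem expect_withDensity {Ω : Type*} [MeasurableSpace Ω] {ν : Measure Ω} {d : Ω → ℝ≥0∞}
    (hd : AEMeasurable d ν) (hfin : ∀ᵐ ω ∂ν, d ω < ⊤) (k : Ω → ℝ) :
    expect (ν.withDensity d) (fun ω => (k ω : EReal)) =
      expect ν (fun ω => (((d ω).toReal * k ω : ℝ) : EReal)) := by
  have key : ∀ k : Ω → ℝ, ∫⁻ ω, ENNReal.ofReal (k ω) ∂(ν.withDensity d) =
      ∫⁻ ω, ENNReal.ofReal ((d ω).toReal * k ω) ∂ν := by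
    intro k
    rw [lintegral_withDensity_eq_lintegral_mul_non_measurable₀ _ hd hfin]
    refine lintegral_congr_ae (hfin.mono fun ω hω => ?_)
    simp only [Pi.mul_apply]
    rw [ENNReal.ofReal_mul ENNReal.toReal_nonneg, ENNReal.ofReal_toReal hω.ne]
  unfold expect
  simp only [← EReal.coe_neg, EReal.real_coe_toENNReal]
  rw [key, key fun ω => -k ω]
  simp only [mul_neg]

/-- A monotone sequence with bounded integrals dominates in expectation anything below its
supremum. -/
theorem expect_le_of_monotone {Ω : Type*} [MeasurableSpace Ω] {ν : Measure Ω}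
    {K : ℕ → Ω → ℝ} (hK : ∀ n, Integrable (K n) ν) (hmono : ∀ ω, Monotone fun n => K n ω)
    {c : ℝ} (hc : ∀ n, ∫ ω, K n ω ∂ν ≤ c) {h : Ω → EReal}
    (hh : ∀ ω, h ω ≤ ⨆ n, (K n ω : EReal)) : expect ν h ≤ c := by
  -- Subtracting `K 0` makes the sequence nonnegative, so monotone convergence applies; `h` itself
  -- need not be measurable.
  set p : ℕ → Ω → ℝ≥0∞ := fun n ω => ENNReal.ofReal (K n ω - K 0 ω) with hp
  have hpi : ∀ n, Integrable (fun ω => K n ω - K 0 ω) ν := fun n => (hK n).sub (hK 0)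
  have hpm : ∀ n, AEMeasurable (p n) ν := fun n => (hpi n).aemeasurable.ennreal_ofReal
  have hsup : ∫⁻ ω, ⨆ n, p n ω ∂ν ≤ ENNReal.ofReal (c - ∫ ω, K 0 ω ∂ν) := by
    rw [lintegral_iSup' hpm (ae_of_all _ fun ω n k hnk =>
      ENNReal.ofReal_le_ofReal (sub_le_sub_right (hmono ω hnk) _))]
    refine iSup_le fun n => ?_
    rw [← ofReal_integral_eq_lintegral_ofReal (hpi n)
      (ae_of_all _ fun ω => sub_nonneg.2 (hmono ω (Nat.zero_le n))),
      integral_sub (hK n) (hK 0)]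
    exact ENNReal.ofReal_le_ofReal (sub_le_sub_right (hc n) _)
  have hsm : AEMeasurable (fun ω => ⨆ n, p n ω) ν := AEMeasurable.iSup hpm
  have hfin : ∀ᵐ ω ∂ν, (⨆ n, p n ω) < ⊤ :=
    ae_lt_top' hsm (hsup.trans_lt ENNReal.ofReal_lt_top).ne
  have hPi : Integrable (fun ω => (⨆ n, p n ω).toReal) ν :=
    integrable_toReal_of_lintegral_ne_top hsm (hsup.trans_lt ENNReal.ofReal_lt_top).ne
  have hle : ∀ᵐ ω ∂ν, h ω ≤ (((⨆ n, p n ω).toReal + K 0 ω : ℝ) : EReal) := by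
    filter_upwards [hfin] with ω hω
    refine (hh ω).trans (iSup_le fun n => EReal.coe_le_coe_iff.2 ?_)
    have := ENNReal.toReal_mono hω.ne (le_iSup (fun n => p n ω) n)
    rw [hp, ENNReal.toReal_ofReal (sub_nonneg.2 (hmono ω (Nat.zero_le n)))] at this
    linarith
  refine (expect_mono_ae hle).trans ?_
  rw [expect_coe (k := fun ω => (⨆ n, p n ω).toReal + K 0 ω) (hPi.add (hK 0)), integral_add hPi (hK 0), integral_toReal hsm hfin]
  refine EReal.coe_le_coe_iff.2 ?_
  have h0 : 0 ≤ c - ∫ ω, K 0 ω ∂ν := sub_nonneg.2 (hc 0)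
  have := ENNReal.toReal_mono ENNReal.ofReal_ne_top hsup
  rw [ENNReal.toReal_ofReal h0] at this
  linarith

/-! ### Generators of divergences -/

namespace IsGenerator

variable {f : ℝ → EReal} (hf : IsGenerator f)
include hf

theorem coe_toReal {x : ℝ} (hx : x ∈ effDom f) : ((f x).toReal : EReal) = f x :=
  EReal.coe_toReal hx.ne (hf.proper x)

theorem nonneg_of_mem {x : ℝ} (hx : x ∈ effDom f) : 0 ≤ x := by
  by_contra hc
  simp [effDom, hf.neg x (not_le.1 hc)] at hx

theorem one_mem_effDom : (1 : ℝ) ∈ effDom f := interior_subset hf.one_mem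

theorem convexOn : ConvexOn ℝ (effDom f) fun x => (f x).toReal := by
  have key : ∀ x ∈ effDom f, ∀ y ∈ effDom f, ∀ a b : ℝ, 0 ≤ a → 0 ≤ b → a + b = 1 →
      f (a * x + b * y) ≤ ((a * (f x).toReal + b * (f y).toReal : ℝ) : EReal) := by
    intro x hx y hy a b ha hb hab
    have h1 : ((x, (f x).toReal) : ℝ × ℝ) ∈ {p : ℝ × ℝ | f p.1 ≤ (p.2 : EReal)} :=
      (hf.coe_toReal hx).ge
    have h2 : ((y, (f y).toReal) : ℝ × ℝ) ∈ {p : ℝ × ℝ | f p.1 ≤ (p.2 : EReal)} :=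
      (hf.coe_toReal hy).ge
    simpa using hf.convex h1 h2 ha hb hab
  have hdom : ∀ x ∈ effDom f, ∀ y ∈ effDom f, ∀ a b : ℝ, 0 ≤ a → 0 ≤ b → a + b = 1 →
      a * x + b * y ∈ effDom f := fun x hx y hy a b ha hb hab =>
    (key x hx y hy a b ha hb hab).trans_lt (EReal.coe_lt_top _)
  refine ⟨fun x hx y hy a b ha hb hab => hdom x hx y hy a b ha hb hab,
    fun x hx y hy a b ha hb hab => ?_⟩
  have := key x hx y hy a b ha hb hab
  rw [← hf.coe_toReal (hdom x hx y hy a b ha hb hab)] at this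
  exact EReal.coe_le_coe_iff.1 this

/-- Points with `f x = ⊤` contribute `⊥` and drop out. One formula, with real numbers under the
supremum, thus covers `lam = 0` and `lam > 0`. -/
theorem scaledConj_eq {lam : ℝ} (hlam : 0 ≤ lam) (y : ℝ) :
    scaledConj f lam y = ⨆ x ∈ effDom f, ((x * y - lam * (f x).toReal : ℝ) : EReal) := by
  unfold scaledConj
  split_ifs with h
  · simp [h]
  have hpos : 0 < lam := lt_of_le_of_ne hlam (Ne.symm h)
  have hb : ∀ x, x ∉ effDom f → (((x * (y / lam) : ℝ) : EReal) - f x) = ⊥ := by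
    intro x hx
    have : f x = ⊤ := by simpa [effDom] using hx
    rw [this, EReal.sub_top]
  apply le_antisymm
  · unfold conj
    rw [mul_comm, ← EReal.le_div_iff_mul_le (by exact_mod_cast hpos) (EReal.coe_ne_top _)]
    refine iSup_le fun x => ?_
    by_cases hx : x ∈ effDom f
    · rw [EReal.le_div_iff_mul_le (by exact_mod_cast hpos) (EReal.coe_ne_top _)]
      refine le_trans (le_of_eq ?_) (le_iSup₂ (f := fun x (_ : x ∈ effDom f) =>
        ((x * y - lam * (f x).toReal : ℝ) : EReal)) x hx)
      rw [← hf.coe_toReal hx, ← EReal.coe_sub, ← EReal.coe_mul, EReal.toReal_coe]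
      congr 1
      field_simp
    · rw [hb x hx]; exact bot_le
  · refine iSup₂_le fun x hx => ?_
    have : ((x * y - lam * (f x).toReal : ℝ) : EReal) =
        (lam : EReal) * (((x * (y / lam) : ℝ) : EReal) - f x) := by
      rw [← hf.coe_toReal hx, ← EReal.coe_sub, ← EReal.coe_mul, EReal.toReal_coe]
      congr 1
      field_simp
    rw [this]
    exact mul_le_mul_of_nonneg_left (le_iSup (fun x => (((x * (y / lam) : ℝ) : EReal) - f x)) x)
      (by exact_mod_cast hlam)

theorem le_scaledConj {lam x : ℝ} (hlam : 0 ≤ lam) (y : ℝ) (hx : x ∈ effDom f) :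
    ((x * y - lam * (f x).toReal : ℝ) : EReal) ≤ scaledConj f lam y := by
  rw [hf.scaledConj_eq hlam]
  exact le_iSup₂ (f := fun x (_ : x ∈ effDom f) =>
    ((x * y - lam * (f x).toReal : ℝ) : EReal)) x hx

/-- The slopes `x` in the supremum are nonnegative because `f` is `⊤` on the negative reals. This
monotonicity makes the dual integrand measurable. -/
theorem monotone_scaledConj {lam : ℝ} (hlam : 0 ≤ lam) : Monotone (scaledConj f lam) := by
  intro y z hyz
  rw [hf.scaledConj_eq hlam]
  refine iSup₂_le fun x hx => le_trans ?_ (hf.le_scaledConj hlam z hx)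
  have := mul_le_mul_of_nonneg_left hyz (hf.nonneg_of_mem hx)
  exact EReal.coe_le_coe_iff.2 (by linarith)

theorem measurable : Measurable f := hf.lsc.measurable

theorem measurable_toReal : Measurable fun x => (f x).toReal := hf.measurable.ereal_toReal

/-- A generator has an affine minorant. -/
theorem exists_affine_le : ∃ s c : ℝ, ∀ x ∈ effDom f, s * x + c ≤ (f x).toReal := by
  obtain ⟨δ, hδ, hball⟩ := Metric.isOpen_iff.1 isOpen_interior 1 hf.one_mem
  have hmem : ∀ x : ℝ, |x - 1| < δ → x ∈ effDom f := fun x hx =>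
    interior_subset (hball (by simpa [Real.dist_eq] using hx))
  have h0 : 1 - δ / 2 ∈ effDom f := hmem _ (by rw [abs_lt]; constructor <;> linarith)
  have h2 : 1 + δ / 2 ∈ effDom f := hmem _ (by rw [abs_lt]; constructor <;> linarith)
  set F : ℝ → ℝ := fun x => (f x).toReal with hF
  set s0 := (F 1 - F (1 - δ / 2)) / (1 - (1 - δ / 2)) with hs0
  set s1 := (F (1 + δ / 2) - F 1) / (1 + δ / 2 - 1) with hs1
  have hss : s0 ≤ s1 := hf.convexOn.slope_mono_adjacent h0 h2 (by linarith) (by linarith)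
  -- The slope is that of a secant to the left of `1`. To the left of `1` only the steeper slope
  -- `s1` is available, and since `x ≥ 0` the replacement costs at most `s1 - s0`.
  refine ⟨s0, F 1 - s0 - (s1 - s0), fun x hx => ?_⟩
  change _ ≤ F x
  rcases lt_trichotomy x 1 with h | h | h
  · have := hf.convexOn.slope_mono_adjacent hx h2 h (by linarith)
    change (F 1 - F x) / (1 - x) ≤ s1 at this
    rw [div_le_iff₀ (by linarith)] at this
    nlinarith [mul_nonneg (sub_nonneg.2 hss) (hf.nonneg_of_mem hx)]
  · subst h; linarith
  · have := hf.convexOn.slope_mono_adjacent h0 hx (by linarith) h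
    change s0 ≤ (F x - F 1) / (x - 1) at this
    rw [le_div_iff₀ (by linarith)] at this
    linarith

/-! ### Densities in the uncertainty set and weak duality -/

variable {Ω : Type*} [MeasurableSpace Ω] {m : Measure Ω} [IsProbabilityMeasure m]

/-- Densities of finite divergence have an integrable divergence integrand. -/
theorem integrable_of_expect_lt_top {L : Ω → ℝ} (hL : Integrable L m)
    (h : expect m (fun ω => f (L ω)) < ⊤) :
    (∀ᵐ ω ∂m, L ω ∈ effDom f) ∧ Integrable (fun ω => (f (L ω)).toReal) m := by
  obtain ⟨s, c, hsc⟩ := hf.exists_affine_le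
  obtain ⟨h1, h2⟩ := exists_integrable_of_expect_lt_top (k := fun ω => s * L ω + c)
    (hf.measurable.comp_aemeasurable hL.aemeasurable)
    ((hL.const_mul s).add (integrable_const c)) (ae_of_all _ fun ω => by
      by_cases hx : L ω ∈ effDom f
      · rw [Function.comp_apply, ← hf.coe_toReal hx]
        exact EReal.coe_le_coe_iff.2 (hsc _ hx)
      · have : f (L ω) = ⊤ := by simpa [effDom] using hx
        rw [Function.comp_apply, this]; exact le_top) h
  refine ⟨h1.mono fun ω hω => ?_, h2⟩
  change f (L ω) < ⊤
  rw [Function.comp_apply] at hω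
  rw [← hω]
  exact EReal.coe_lt_top _

theorem density_of_mem_ball {ρ : ℝ} {m' : Measure Ω} (h : m' ∈ ball f m ρ) :
    (∀ᵐ ω ∂m, (m'.rnDeriv m ω).toReal ∈ effDom f) ∧
    Integrable (fun ω => (m'.rnDeriv m ω).toReal) m ∧
    ∫ ω, (m'.rnDeriv m ω).toReal ∂m = 1 ∧
    Integrable (fun ω => (f (m'.rnDeriv m ω).toReal).toReal) m ∧
    ∫ ω, (f (m'.rnDeriv m ω).toReal).toReal ∂m ≤ ρ + (f 1).toReal := by
  obtain ⟨hp, hac, hd⟩ := h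
  have hL : Integrable (fun ω => (m'.rnDeriv m ω).toReal) m := Measure.integrable_toReal_rnDeriv
  have hle : expect m (fun ω => f (m'.rnDeriv m ω).toReal) ≤ ((ρ + (f 1).toReal : ℝ) : EReal) := by
    unfold fDivergence at hd
    rw [← hf.coe_toReal hf.one_mem_effDom, EReal.sub_le_iff_le_add
      (Or.inl (EReal.coe_ne_bot _)) (Or.inl (EReal.coe_ne_top _)), ← EReal.coe_add] at hd
    exact hd
  obtain ⟨h1, h2⟩ := hf.integrable_of_expect_lt_top hL (hle.trans_lt (EReal.coe_lt_top _))
  refine ⟨h1, hL, ?_, h2, ?_⟩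
  · rw [Measure.integral_toReal_rnDeriv hac]; simp
  · rw [expect_eq_integral_toReal (h1.mono fun ω hω => hf.coe_toReal hω) h2] at hle
    exact EReal.coe_le_coe_iff.1 hle

theorem withDensity_mem_ball {ρ : ℝ} {L : Ω → ℝ} (hL0 : ∀ ω, 0 ≤ L ω)
    (hLi : Integrable L m) (hL1 : ∫ ω, L ω ∂m = 1) (hLD : ∀ᵐ ω ∂m, L ω ∈ effDom f)
    (hfi : Integrable (fun ω => (f (L ω)).toReal) m)
    (hfρ : ∫ ω, (f (L ω)).toReal ∂m ≤ ρ + (f 1).toReal) :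
    m.withDensity (fun ω => ENNReal.ofReal (L ω)) ∈ ball f m ρ := by
  refine ⟨⟨?_⟩, withDensity_absolutelyContinuous _ _, ?_⟩
  · rw [withDensity_apply _ MeasurableSet.univ, setLIntegral_univ,
      ← ofReal_integral_eq_lintegral_ofReal hLi (ae_of_all _ hL0), hL1, ENNReal.ofReal_one]
  · have hrn := Measure.rnDeriv_withDensity₀ m hLi.aemeasurable.ennreal_ofReal
    unfold fDivergence
    rw [expect_congr_ae (k := fun ω => f (L ω)) (hrn.mono fun ω hω => by
      simp only [hω, ENNReal.toReal_ofReal (hL0 ω)]),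
      expect_eq_integral_toReal (hLD.mono fun ω hω => hf.coe_toReal hω) hfi,
      ← hf.coe_toReal hf.one_mem_effDom, ← EReal.coe_sub]
    exact EReal.coe_le_coe_iff.2 (by linarith)

omit hf [IsProbabilityMeasure m] in
theorem expect_withDensity_ofReal {L : Ω → ℝ} (hL0 : ∀ ω, 0 ≤ L ω)
    (hLi : Integrable L m) {ℓ : Ω → ℝ} (hi : Integrable (fun ω => L ω * ℓ ω) m) :
    expect (m.withDensity (fun ω => ENNReal.ofReal (L ω))) (fun ω => (ℓ ω : EReal)) =
      ((∫ ω, L ω * ℓ ω ∂m : ℝ) : EReal) := by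
  rw [expect_withDensity hLi.aemeasurable.ennreal_ofReal
    (ae_of_all _ fun ω => ENNReal.ofReal_lt_top), ← expect_coe hi]
  simp only [ENNReal.toReal_ofReal (hL0 _)]

omit [IsProbabilityMeasure m] in
theorem dualLoss_eq (ρ : ℝ) (ℓ : Ω → ℝ) (lam mu : ℝ) :
    dualLoss f m ρ ℓ lam mu = ((lam * (ρ + (f 1).toReal) + mu : ℝ) : EReal) +
      expect m (fun ω => scaledConj f lam (ℓ ω - mu)) := by
  unfold dualLoss
  rw [← hf.coe_toReal hf.one_mem_effDom]
  simp only [EReal.toReal_coe, EReal.coe_add, EReal.coe_mul]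

/-- Where the dual objective is finite, its integrand is finite a.e. and integrable. -/
theorem integrable_scaledConj {ρ : ℝ} {ℓ : Ω → ℝ} (hℓ : Integrable ℓ m) {lam mu : ℝ}
    (hlam : 0 ≤ lam) (h : dualLoss f m ρ ℓ lam mu < ⊤) :
    (∀ᵐ ω ∂m, ((scaledConj f lam (ℓ ω - mu)).toReal : EReal) = scaledConj f lam (ℓ ω - mu)) ∧
    Integrable (fun ω => (scaledConj f lam (ℓ ω - mu)).toReal) m ∧
    dualLoss f m ρ ℓ lam mu = ((lam * (ρ + (f 1).toReal) + mu +
      ∫ ω, (scaledConj f lam (ℓ ω - mu)).toReal ∂m : ℝ) : EReal) := by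
  rw [hf.dualLoss_eq] at h ⊢
  have h' : expect m (fun ω => scaledConj f lam (ℓ ω - mu)) < ⊤ := by
    by_contra hc
    rw [not_lt, top_le_iff] at hc
    rw [hc, EReal.coe_add_top] at h
    exact lt_irrefl _ h
  obtain ⟨h1, h2⟩ := exists_integrable_of_expect_lt_top
    (k := fun ω => 1 * (ℓ ω - mu) - lam * (f 1).toReal)
    ((hf.monotone_scaledConj hlam).measurable.comp_aemeasurable (hℓ.aemeasurable.sub_const mu))
    (((hℓ.sub (integrable_const mu)).const_mul 1).sub (integrable_const _))
    (ae_of_all _ fun ω => hf.le_scaledConj hlam _ hf.one_mem_effDom) h'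
  refine ⟨h1, h2, ?_⟩
  have he := expect_eq_integral_toReal h1 h2
  simp only [Function.comp_def] at he
  rw [he, ← EReal.coe_add]

/-- This is Fenchel's inequality, integrated. Only the upper bound is known to be integrable, so the
comparison is made through `expect`. -/
theorem expect_le_dualLoss {ρ : ℝ} {ℓ : Ω → ℝ} (hℓ : Integrable ℓ m) {lam mu : ℝ}
    (hlam : 0 ≤ lam) {m' : Measure Ω} (hm' : m' ∈ ball f m ρ) :
    expect m' (fun ω => (ℓ ω : EReal)) ≤ dualLoss f m ρ ℓ lam mu := by
  by_cases htop : dualLoss f m ρ ℓ lam mu < ⊤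
  swap
  · rw [not_lt, top_le_iff] at htop
    rw [htop]; exact le_top
  obtain ⟨h1, h2, h3⟩ := hf.integrable_scaledConj hℓ hlam htop
  obtain ⟨hD, hLi, hL1, hfi, hfρ⟩ := hf.density_of_mem_ball hm'
  have := hm'.1
  rw [h3]
  conv_lhs => rw [← Measure.withDensity_rnDeriv_eq m' m hm'.2.1]
  rw [expect_withDensity (Measure.measurable_rnDeriv _ _).aemeasurable
    (Measure.rnDeriv_lt_top m' m)]
  set L : Ω → ℝ := fun ω => (m'.rnDeriv m ω).toReal with hL
  have hle : ∀ᵐ ω ∂m, ((L ω * ℓ ω : ℝ) : EReal) ≤ ((lam * (f (L ω)).toReal + mu * L ω +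
      (scaledConj f lam (ℓ ω - mu)).toReal : ℝ) : EReal) := by
    filter_upwards [h1, hD] with ω hω hDω
    have := hf.le_scaledConj hlam (ℓ ω - mu) hDω
    rw [← hω] at this
    have := EReal.coe_le_coe_iff.1 this
    exact EReal.coe_le_coe_iff.2 (by linarith)
  have hA : Integrable (fun ω => lam * (f (L ω)).toReal + mu * L ω) m :=
    (hfi.const_mul lam).add (hLi.const_mul mu)
  refine (expect_mono_ae hle).trans ?_
  rw [expect_coe (k := fun ω => lam * (f (L ω)).toReal + mu * L ω +
      (scaledConj f lam (ℓ ω - mu)).toReal)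
      (hA.add h2), integral_add hA h2,
    integral_add (hfi.const_mul lam) (hLi.const_mul mu), integral_const_mul, integral_const_mul,
    hL1]
  refine EReal.coe_le_coe_iff.2 ?_
  have := mul_le_mul_of_nonneg_left hfρ hlam
  linarith

theorem worstLoss_le_dualLoss {ρ : ℝ} {ℓ : Ω → ℝ} (hℓ : Integrable ℓ m) {lam mu : ℝ}
    (hlam : 0 ≤ lam) : worstLoss f m ρ ℓ ≤ dualLoss f m ρ ℓ lam mu :=
  iSup₂_le fun _ hm' => hf.expect_le_dualLoss hℓ hlam hm'

/-! ### Strong duality through simple densities -/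

/-- The supremum defining the scaled conjugate is already attained along rational points. -/
theorem scaledConj_le_of_rat {lam : ℝ} (hlam : 0 ≤ lam) (y : ℝ) {B : EReal}
    (hB : ∀ x ∈ effDom f ∩ range ((↑) : ℚ → ℝ), ((x * y - lam * (f x).toReal : ℝ) : EReal) ≤ B) :
    scaledConj f lam y ≤ B := by
  rw [hf.scaledConj_eq hlam]
  refine iSup₂_le fun x hx => ?_
  have h1D := hf.one_mem_effDom
  by_cases hx1 : x = 1
  · subst hx1
    exact hB _ ⟨h1D, ⟨1, by simp⟩⟩
  set k : ℝ → ℝ := fun x => x * y - lam * (f x).toReal with hk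
  refine EReal.le_of_forall_lt_iff_le.1 fun c hc => ?_
  -- The function `k` is concave, so on the segment from `x` to `1` it lies above its chord. The
  -- chord tends to `k x` as `t → 0`, and rational points occur on the segment arbitrarily close to
  -- `x`.
  have hBc : ∀ t : ℝ, 0 ≤ t → t ≤ 1 → (∃ q : ℚ, (q : ℝ) = (1 - t) * x + t * 1) →
      (1 - t) * k x + t * k 1 ≤ c := by
    rintro t ht0 ht1 ⟨q, hq⟩
    have hz : (1 - t) * x + t * 1 ∈ effDom f :=
      hf.convexOn.1 hx h1D (sub_nonneg.2 ht1) ht0 (by ring)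
    have h1 := (hB _ ⟨hz, ⟨q, hq⟩⟩).trans hc.le
    have h2 := hf.convexOn.2 hx h1D (sub_nonneg.2 ht1) ht0 (by ring)
    simp only [smul_eq_mul] at h2
    have h3 := mul_le_mul_of_nonneg_left h2 hlam
    have h4 := EReal.coe_le_coe_iff.1 h1
    simp only [hk]
    linarith
  by_contra hlt
  rw [EReal.coe_le_coe_iff, not_le] at hlt
  have hcont : Tendsto (fun t : ℝ => (1 - t) * k x + t * k 1) (𝓝[>] 0) (𝓝 (k x)) := by
    have : Continuous fun t : ℝ => (1 - t) * k x + t * k 1 := by fun_prop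
    simpa using (this.tendsto 0).mono_left nhdsWithin_le_nhds
  have hev := (hcont.eventually (lt_mem_nhds hlt)).and (Ioo_mem_nhdsGT (zero_lt_one (α := ℝ)))
  obtain ⟨ε, hε, hsub⟩ := mem_nhdsGT_iff_exists_Ioo_subset.1 hev
  have hε : 0 < ε := hε
  obtain ⟨q, hq⟩ : ∃ q : ℚ, (q : ℝ) ∈ Ioo (min x (x + ε * (1 - x))) (max x (x + ε * (1 - x))) := by
    obtain ⟨q, h1, h2⟩ := exists_rat_btwn (x := min x (x + ε * (1 - x)))
      (y := max x (x + ε * (1 - x))) (min_lt_max.2 fun h : x = x + ε * (1 - x) => by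
        have : ε * (1 - x) = 0 := by linarith
        rcases mul_eq_zero.1 this with h | h
        · exact hε.ne' h
        · exact hx1 (by linarith))
    exact ⟨q, h1, h2⟩
  set t := (q - x) / (1 - x) with ht
  have hne : (1 - x) ≠ 0 := fun h => hx1 (by linarith)
  have htmem : t ∈ Ioo 0 ε := by
    rcases lt_or_gt_of_ne hne with h | h
    · have hm : ε * (1 - x) < 0 := mul_neg_of_pos_of_neg hε h
      rw [min_eq_right (by linarith), max_eq_left (by linarith)] at hq
      exact ⟨div_pos_of_neg_of_neg (by linarith [hq.2]) h,
        (div_lt_iff_of_neg h).2 (by linarith [hq.1])⟩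
    · have hm : 0 < ε * (1 - x) := mul_pos hε h
      rw [min_eq_left (by linarith), max_eq_right (by linarith)] at hq
      exact ⟨div_pos (by linarith [hq.1]) h, (div_lt_iff₀ h).2 (by linarith [hq.2])⟩
  obtain ⟨h1, h2⟩ := hsub htmem
  have := hBc t h2.1.le h2.2.le ⟨q, by rw [ht]; field_simp; ring⟩
  exact absurd this (not_le.2 h1)

omit hf in
theorem simpleFunc_integrable {ℓ : Ω → ℝ} (hℓ : Integrable ℓ m) (L : SimpleFunc Ω ℝ) :
    Integrable L m ∧ Integrable (fun ω => (f (L ω)).toReal) m ∧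
      Integrable (fun ω => L ω * ℓ ω) m := by
  refine ⟨L.integrable_of_isFiniteMeasure,
    (L.map fun x => (f x).toReal).integrable_of_isFiniteMeasure, ?_⟩
  obtain ⟨C, hC⟩ := L.exists_forall_norm_le
  exact hℓ.bdd_mul L.aestronglyMeasurable (ae_of_all _ hC)

/-- Interchange of supremum and expectation for the integrand of the dual objective. -/
theorem expect_scaledConj_le {ℓ : Ω → ℝ} (hm : Measurable ℓ) (hℓ : Integrable ℓ m) {lam mu c : ℝ}
    (hlam : 0 ≤ lam) (hc : ∀ L : SimpleFunc Ω ℝ, (∀ ω, L ω ∈ effDom f) →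
      ∫ ω, (L ω * (ℓ ω - mu) - lam * (f (L ω)).toReal) ∂m ≤ c) :
    expect m (fun ω => scaledConj f lam (ℓ ω - mu)) ≤ c := by
  obtain ⟨u, hu⟩ := ((countable_range ((↑) : ℚ → ℝ)).mono
    (inter_subset_right (s := effDom f))).exists_eq_range ⟨1, hf.one_mem_effDom, 1, by simp⟩
  have huD : ∀ n, u n ∈ effDom f := fun n => by
    have : u n ∈ effDom f ∩ range ((↑) : ℚ → ℝ) := hu ▸ mem_range_self n
    exact this.1
  set k : ℝ → Ω → ℝ := fun x ω => x * (ℓ ω - mu) - lam * (f x).toReal with hk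
  have hkm : ∀ L : SimpleFunc Ω ℝ, Measurable fun ω => k (L ω) ω := fun L =>
    (L.measurable.mul (hm.sub_const mu)).sub ((hf.measurable_toReal.comp L.measurable).const_mul lam)
  -- The running maximum of the integrands over the first rational points is realized by a simple
  -- density: switch to the new value on the measurable set where it does at least as well.
  have step : ∀ (L : SimpleFunc Ω ℝ) (n : ℕ), ∃ L' : SimpleFunc Ω ℝ,
      (∀ ω, k (L' ω) ω = max (k (L ω) ω) (k (u n) ω)) ∧
      ((∀ ω, L ω ∈ effDom f) → ∀ ω, L' ω ∈ effDom f) := by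
    intro L n
    refine ⟨SimpleFunc.piecewise {ω | k (L ω) ω ≤ k (u n) ω}
      (measurableSet_le (hkm L) (hkm (SimpleFunc.const Ω (u n)))) (SimpleFunc.const Ω (u n)) L,
      fun ω => ?_, fun h ω => ?_⟩
    · by_cases h : k (L ω) ω ≤ k (u n) ω
      · simp [SimpleFunc.piecewise_apply, h]
      · simp [SimpleFunc.piecewise_apply, h, (not_le.1 h).le]
    · by_cases h' : k (L ω) ω ≤ k (u n) ω
      · simpa [SimpleFunc.piecewise_apply, h'] using huD n
      · simpa [SimpleFunc.piecewise_apply, h'] using h ω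
  choose next hnext hnextD using step
  let S : ℕ → SimpleFunc Ω ℝ := fun n =>
    Nat.rec (SimpleFunc.const Ω 1) (fun n L => next L n) n
  have hSs : ∀ n ω, k (S (n + 1) ω) ω = max (k (S n ω) ω) (k (u n) ω) := fun n ω =>
    hnext (S n) n ω
  have hSD : ∀ n ω, S n ω ∈ effDom f := by
    intro n
    induction n with
    | zero => exact fun ω => hf.one_mem_effDom
    | succ n ih => exact hnextD (S n) n ih
  refine expect_le_of_monotone (K := fun n ω => k (S n ω) ω) (fun n => ?_) (fun ω => ?_)
    (fun n => hc (S n) (hSD n)) (fun ω => ?_)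
  · obtain ⟨_, h2, h3⟩ := simpleFunc_integrable (f := f) (hℓ.sub (integrable_const mu)) (S n)
    exact h3.sub (h2.const_mul lam)
  · exact monotone_nat_of_le_succ fun n => by simp only [hSs]; exact le_max_left _ _
  · refine hf.scaledConj_le_of_rat hlam _ fun x hx => ?_
    rw [hu] at hx
    obtain ⟨n, rfl⟩ := hx
    refine le_trans ?_ (le_iSup _ (n + 1))
    refine EReal.coe_le_coe_iff.2 ?_
    rw [hSs]
    exact le_max_right _ _

/-- Values attained by simple densities: mass defect, divergence excess, and loss. -/
theorem convex_values (ρ : ℝ) {ℓ : Ω → ℝ} (hℓ : Integrable ℓ m) :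
    Convex ℝ {p : ℝ × ℝ × ℝ | ∃ L : SimpleFunc Ω ℝ, (∀ ω, L ω ∈ effDom f) ∧
      p.1 = ∫ ω, L ω ∂m - 1 ∧ ∫ ω, (f (L ω)).toReal ∂m - (f 1).toReal - ρ ≤ p.2.1 ∧
      p.2.2 ≤ ∫ ω, L ω * ℓ ω ∂m} := by
  rintro ⟨u, v, w⟩ ⟨L, hL, h1, h2, h3⟩ ⟨u', v', w'⟩ ⟨L', hL', h1', h2', h3'⟩ a b ha hb hab
  simp only at h1 h2 h3 h1' h2' h3'
  obtain ⟨i1, i2, i3⟩ := simpleFunc_integrable (f := f) hℓ L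
  obtain ⟨i1', i2', i3'⟩ := simpleFunc_integrable (f := f) hℓ L'
  obtain ⟨j1, j2, j3⟩ := simpleFunc_integrable (f := f) hℓ (a • L + b • L')
  have hb' : b = 1 - a := by linarith
  refine ⟨a • L + b • L', fun ω => hf.convexOn.1 (hL ω) (hL' ω) ha hb hab, ?_, ?_, ?_⟩
  · have : ∫ ω, (a • L + b • L') ω ∂m = a * ∫ ω, L ω ∂m + b * ∫ ω, L' ω ∂m := by
      rw [← integral_const_mul, ← integral_const_mul,
        ← integral_add (i1.const_mul a) (i1'.const_mul b)]
      rfl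
    simp only [Prod.smul_mk, Prod.mk_add_mk, smul_eq_mul]
    rw [this, h1, h1', hb']; ring
  · have : ∫ ω, (f ((a • L + b • L') ω)).toReal ∂m ≤
        a * ∫ ω, (f (L ω)).toReal ∂m + b * ∫ ω, (f (L' ω)).toReal ∂m := by
      rw [← integral_const_mul, ← integral_const_mul,
        ← integral_add (i2.const_mul a) (i2'.const_mul b)]
      exact integral_mono j2 ((i2.const_mul a).add (i2'.const_mul b))
        fun ω => hf.convexOn.2 (hL ω) (hL' ω) ha hb hab
    simp only [Prod.smul_mk, Prod.mk_add_mk, smul_eq_mul]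
    have e1 := mul_le_mul_of_nonneg_left h2 ha
    have e2 := mul_le_mul_of_nonneg_left h2' hb
    have e3 : a * ((f 1).toReal + ρ) + b * ((f 1).toReal + ρ) = (f 1).toReal + ρ := by
      rw [← add_mul, hab, one_mul]
    linarith
  · have : ∫ ω, (a • L + b • L') ω * ℓ ω ∂m =
        a * ∫ ω, L ω * ℓ ω ∂m + b * ∫ ω, L' ω * ℓ ω ∂m := by
      rw [← integral_const_mul, ← integral_const_mul,
        ← integral_add (i3.const_mul a) (i3'.const_mul b)]
      refine integral_congr_ae (ae_of_all _ fun ω => ?_)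
      change (a * L ω + b * L' ω) * ℓ ω = a * (L ω * ℓ ω) + b * (L' ω * ℓ ω)
      ring
    simp only [Prod.smul_mk, Prod.mk_add_mk, smul_eq_mul]
    rw [this]
    exact add_le_add (mul_le_mul_of_nonneg_left h3 ha) (mul_le_mul_of_nonneg_left h3' hb)

/-- Existence of multipliers for the maximization over simple densities. -/
theorem exists_multipliers {ρ : ℝ} (hρ : 0 < ρ) {ℓ : Ω → ℝ} (hℓ : Integrable ℓ m) {V : ℝ}
    (hV : ∀ L : SimpleFunc Ω ℝ, (∀ ω, L ω ∈ effDom f) → ∫ ω, L ω ∂m = 1 →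
      ∫ ω, (f (L ω)).toReal ∂m ≤ ρ + (f 1).toReal → ∫ ω, L ω * ℓ ω ∂m ≤ V) :
    ∃ lam mu : ℝ, 0 ≤ lam ∧ ∀ L : SimpleFunc Ω ℝ, (∀ ω, L ω ∈ effDom f) →
      ∫ ω, L ω * ℓ ω ∂m - mu * (∫ ω, L ω ∂m - 1) -
        lam * (∫ ω, (f (L ω)).toReal ∂m - (f 1).toReal - ρ) ≤ V := by
  set C : Set (ℝ × ℝ × ℝ) := {p | ∃ L : SimpleFunc Ω ℝ, (∀ ω, L ω ∈ effDom f) ∧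
      p.1 = ∫ ω, L ω ∂m - 1 ∧ ∫ ω, (f (L ω)).toReal ∂m - (f 1).toReal - ρ ≤ p.2.1 ∧
      p.2.2 ≤ ∫ ω, L ω * ℓ ω ∂m} with hCdef
  have hC : Convex ℝ C := hf.convex_values ρ hℓ
  have h1D := hf.one_mem_effDom
  obtain ⟨δ, hδ, hnear⟩ : ∃ δ > 0, ∀ x : ℝ, |x - 1| < δ →
      x ∈ effDom f ∧ (f x).toReal - (f 1).toReal - ρ ≤ -ρ / 2 := by
    have hc : ContinuousAt (fun x => (f x).toReal) 1 :=
      (hf.convexOn.continuousOn_interior).continuousAt (isOpen_interior.mem_nhds hf.one_mem)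
    have hev : ∀ᶠ x in 𝓝 (1 : ℝ), x ∈ effDom f ∧ (f x).toReal < (f 1).toReal + ρ / 2 :=
      Filter.Eventually.and (mem_interior_iff_mem_nhds.1 hf.one_mem)
        (hc.eventually (gt_mem_nhds (by linarith)))
    obtain ⟨δ, hδ, h⟩ := Metric.eventually_nhds_iff.1 hev
    exact ⟨δ, hδ, fun x hx => ⟨(h hx).1, by linarith [(h hx).2]⟩⟩
  set K : ℝ := (1 + δ) * |∫ ω, ℓ ω ∂m| with hK
  -- The constants `1 + u` with `|u| < δ` keep the divergence constraint strictly satisfied, so the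
  -- convex set contains an open box.
  have hsub : Ioo (-δ) δ ×ˢ (Ioi (-ρ / 2) ×ˢ Iio (-K)) ⊆ C := by
    rintro ⟨u, v, w⟩ ⟨⟨hu1, hu2⟩, hv, hw⟩
    have hv : -ρ / 2 < v := hv
    have hw : w < -K := hw
    simp only at hu1 hu2
    obtain ⟨g1, g2⟩ := hnear (1 + u) (by rw [abs_lt]; constructor <;> linarith)
    refine ⟨SimpleFunc.const Ω (1 + u), fun _ => g1, by simp, ?_, ?_⟩
    · simp only [SimpleFunc.const_apply, integral_const, probReal_univ, one_smul]
      exact g2.trans hv.le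
    · simp only [SimpleFunc.const_apply, integral_const_mul]
      refine hw.le.trans ?_
      have := abs_mul (1 + u) (∫ ω, ℓ ω ∂m)
      have h2 : |1 + u| ≤ 1 + δ := by rw [abs_le]; constructor <;> linarith
      have h3 := mul_le_mul_of_nonneg_right h2 (abs_nonneg (∫ ω, ℓ ω ∂m))
      linarith [neg_abs_le ((1 + u) * ∫ ω, ℓ ω ∂m)]
  have hz : ((0 : ℝ), -ρ / 4, -K - 1) ∈ interior C := by
    refine interior_maximal hsub (isOpen_Ioo.prod (isOpen_Ioi.prod isOpen_Iio)) ?_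
    refine ⟨⟨?_, ?_⟩, ?_, ?_⟩ <;> simp only [mem_Ioi, mem_Iio] <;> linarith
  -- Otherwise some `V + e` with `e > 0` would be reached by a feasible density.
  have hnot : ((0 : ℝ), (0 : ℝ), V) ∉ interior C := by
    intro h
    have hcont : Continuous fun e : ℝ => ((0 : ℝ), (0 : ℝ), V + e) := by fun_prop
    have h' : ((0 : ℝ), (0 : ℝ), V + 0) ∈ interior C := by simpa using h
    have := (hcont.tendsto 0).eventually (isOpen_interior.mem_nhds h')
    obtain ⟨e, he, hpos⟩ := ((this.filter_mono nhdsWithin_le_nhds).and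
      (self_mem_nhdsWithin (s := Ioi (0 : ℝ)))).exists
    obtain ⟨L, hL, e1, e2, e3⟩ := interior_subset he
    simp only at e1 e2 e3
    have := hV L hL (by linarith) (by linarith)
    have : 0 < e := hpos
    linarith
  obtain ⟨φ, hφ⟩ := geometric_hahn_banach_open_point hC.interior isOpen_interior hnot
  have hφC : ∀ z ∈ C, φ z ≤ φ (0, 0, V) := by
    intro z hzC
    have hcl : z ∈ closure (interior C) := by
      rw [hC.closure_interior_eq_closure_of_nonempty_interior ⟨_, hz⟩]
      exact subset_closure hzC
    exact closure_minimal (fun x hx => (hφ x hx).le) (isClosed_Iic.preimage φ.continuous) hcl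
  set q := φ (1, 0, 0) with hq
  set p := φ (0, 1, 0) with hp
  set r := φ (0, 0, 1) with hr
  have hdec : ∀ u v w : ℝ, φ (u, v, w) = u * q + v * p + w * r := by
    intro u v w
    have : ((u, v, w) : ℝ × ℝ × ℝ) = u • (1, 0, 0) + v • (0, 1, 0) + w • (0, 0, 1) := by simp
    rw [this, map_add, map_add, map_smul, map_smul, map_smul]
    simp [hq, hp, hr]
  have hzC := interior_subset hz
  have hp0 : p ≤ 0 := by
    by_contra hpp
    rw [not_le] at hpp
    obtain ⟨L, hL, e1, e2, e3⟩ := hzC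
    simp only at e1 e2 e3
    -- The second coordinate may be increased freely within `C`. If `p > 0`, this `T` pushes `φ`
    -- above its bound; the sign of `r` is obtained likewise by lowering the third coordinate.
    set T := |V * r| + |(-K - 1) * r|
    have := hφC (0, T / p + 1, -K - 1) ⟨L, hL, e1, by
      have : 0 ≤ T / p := by positivity
      simp only; linarith, e3⟩
    rw [hdec, hdec, add_mul, div_mul_cancel₀ _ hpp.ne'] at this
    have a1 := le_abs_self (V * r)
    have a2 := neg_abs_le ((-K - 1) * r)
    have : T = |V * r| + |(-K - 1) * r| := rfl
    linarith
  have hr0 : 0 ≤ r := by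
    by_contra hrr
    rw [not_le] at hrr
    obtain ⟨L, hL, e1, e2, e3⟩ := hzC
    simp only at e1 e2 e3
    set T := |V * r| + |(-ρ / 4) * p|
    have hT : 0 ≤ T := by positivity
    have := hφC (0, -ρ / 4, T / r + (-K - 1) + min V 0 - 1) ⟨L, hL, e1, e2, by
      have h1 : T / r ≤ 0 := div_nonpos_of_nonneg_of_nonpos hT hrr.le
      have h2 : min V 0 ≤ 0 := min_le_right _ _
      simp only; linarith⟩
    have hK0 : 0 ≤ K := by positivity
    rw [hdec, hdec] at this
    have e : (T / r + (-K - 1) + min V 0 - 1) * r = T + (-K - 1 + min V 0 - 1) * r := by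
      rw [sub_mul, add_mul, add_mul, div_mul_cancel₀ _ hrr.ne]; ring
    rw [e] at this
    have a1 := le_abs_self (V * r)
    have a2 := neg_abs_le ((-ρ / 4) * p)
    have a3 : 0 < (-K - 1 + min V 0 - 1) * r :=
      mul_pos_of_neg_of_neg (by linarith [min_le_right V 0]) hrr
    have : T = |V * r| + |(-ρ / 4) * p| := rfl
    linarith
  -- Slater's condition: with `r = 0`, strict separation at the point with second coordinate `-ρ /
  -- 4` would force `p > 0`.
  have hrpos : 0 < r := by
    refine lt_of_le_of_ne hr0 fun h => ?_
    have := hφ _ hz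
    rw [hdec, hdec, ← h] at this
    nlinarith
  refine ⟨-p / r, -q / r, div_nonneg (by linarith) hrpos.le, fun L hL => ?_⟩
  have := hφC (_, _, _) ⟨L, hL, rfl, le_rfl, le_rfl⟩
  rw [hdec, hdec] at this
  rw [← mul_le_mul_iff_of_pos_right hrpos]
  have e : (∫ ω, L ω * ℓ ω ∂m - -q / r * (∫ ω, L ω ∂m - 1) -
        -p / r * (∫ ω, (f (L ω)).toReal ∂m - (f 1).toReal - ρ)) * r =
      (∫ ω, L ω ∂m - 1) * q + (∫ ω, (f (L ω)).toReal ∂m - (f 1).toReal - ρ) * p +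
        (∫ ω, L ω * ℓ ω ∂m) * r := by
    field_simp
    ring
  rw [e]
  linarith

/-- Strong duality for the worst-case expected loss. -/
theorem worstLoss_eq {ρ : ℝ} (hρ : 0 < ρ) {ℓ : Ω → ℝ} (hm : Measurable ℓ) (hℓ : Integrable ℓ m) :
    worstLoss f m ρ ℓ = ⨅ lam : ℝ, ⨅ _ : 0 ≤ lam, ⨅ mu : ℝ, dualLoss f m ρ ℓ lam mu := by
  refine le_antisymm (le_iInf fun lam => le_iInf fun hlam => le_iInf fun mu =>
    hf.worstLoss_le_dualLoss hℓ hlam) ?_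
  refine EReal.le_of_forall_lt_iff_le.1 fun V hV => ?_
  obtain ⟨lam, mu, hlam, h⟩ := hf.exists_multipliers hρ hℓ (V := V) fun L hLD hL1 hLρ => by
    obtain ⟨i1, i2, i3⟩ := simpleFunc_integrable (f := f) hℓ L
    have hL0 : ∀ ω, 0 ≤ L ω := fun ω => hf.nonneg_of_mem (hLD ω)
    have hb := hf.withDensity_mem_ball hL0 i1 hL1 (ae_of_all _ hLD) i2 hLρ
    have := (le_iSup₂ (f := fun m' (_ : m' ∈ ball f m ρ) =>
      expect m' (fun ω => (ℓ ω : EReal))) _ hb).trans hV.le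
    rw [expect_withDensity_ofReal hL0 i1 i3] at this
    exact EReal.coe_le_coe_iff.1 this
  refine (iInf_le_of_le lam (iInf_le_of_le hlam (iInf_le _ mu))).trans ?_
  rw [hf.dualLoss_eq]
  have := hf.expect_scaledConj_le hm hℓ (lam := lam) (mu := mu)
    (c := V - (lam * (ρ + (f 1).toReal) + mu)) hlam fun L hLD => by
      obtain ⟨i1, i2, i3⟩ := simpleFunc_integrable (f := f) hℓ L
      have e : ∫ ω, (L ω * (ℓ ω - mu) - lam * (f (L ω)).toReal) ∂m =
          ∫ ω, L ω * ℓ ω ∂m - mu * ∫ ω, L ω ∂m - lam * ∫ ω, (f (L ω)).toReal ∂m := by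
        rw [← integral_const_mul, ← integral_const_mul, ← integral_sub i3 (i1.const_mul mu),
          ← integral_sub (f := fun ω => L ω * ℓ ω - mu * L ω) (i3.sub (i1.const_mul mu))
            (i2.const_mul lam)]
        refine integral_congr_ae (ae_of_all _ fun ω => ?_)
        simp only
        ring
      have := h L hLD
      rw [e]
      linarith
  refine (add_le_add le_rfl this).trans ?_
  rw [← EReal.coe_add]
  exact EReal.coe_le_coe_iff.2 (by linarith)

end IsGenerator

/-! ### Maximizers in the conjugate and their extreme selections -/

/-- The points at which the supremum defining the conjugate is attained. -/
def argmax (f : ℝ → EReal) (η : ℝ) : Set ℝ :=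
  {x | x ∈ effDom f ∧ ∀ y ∈ effDom f, y * η - (f y).toReal ≤ x * η - (f x).toReal}

/-- The interior of the effective domain of the conjugate. -/
def conjInterior (f : ℝ → EReal) : Set ℝ :=
  {η | ∃ δ > 0, ∃ c : ℝ, ∀ x ∈ effDom f, x * (η + δ) - (f x).toReal ≤ c}

open Classical in
/-- The smallest maximizer, on the interior of the domain of the conjugate. -/
noncomputable def selMin (f : ℝ → EReal) (η : ℝ) : ℝ :=
  if η ∈ conjInterior f then sInf (argmax f η) else 0

open Classical in
/-- The largest maximizer, on the interior of the domain of the conjugate. -/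
noncomputable def selMax (f : ℝ → EReal) (η : ℝ) : ℝ :=
  if η ∈ conjInterior f then sSup (argmax f η) else 0

theorem isLowerSet_conjInterior {f : ℝ → EReal} : IsLowerSet (conjInterior f) := by
  rintro a b hba ⟨δ, hδ, c, h⟩
  exact ⟨δ + (a - b), by linarith, c, fun x hx => by
    rw [show b + (δ + (a - b)) = a + δ by ring]; exact h x hx⟩

/-- Adding the two optimality inequalities gives `(x' - x) * (η' - η) ≥ 0`. -/
theorem argmax_mono {f : ℝ → EReal} {η η' x x' : ℝ} (h : η < η') (hx : x ∈ argmax f η)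
    (hx' : x' ∈ argmax f η') : x ≤ x' := by
  have h1 := hx.2 x' hx'.1
  have h2 := hx'.2 x hx.1
  by_contra hc
  nlinarith [mul_pos (sub_pos.2 (not_le.1 hc)) (sub_pos.2 h)]

/-- The optimality of `x` and of `xs n` traps `f (xs n)` between two affine expressions with the
same limit. No continuity of `f` is used, so limits at the boundary of the domain are covered. -/
theorem tendsto_toReal_argmax {f : ℝ → EReal} {η x : ℝ} (hx : x ∈ argmax f η) {ηs xs : ℕ → ℝ}
    (hη : Tendsto ηs atTop (𝓝 η)) (hxs : ∀ n, xs n ∈ argmax f (ηs n))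
    (hlim : Tendsto xs atTop (𝓝 x)) :
    Tendsto (fun n => (f (xs n)).toReal) atTop (𝓝 (f x).toReal) := by
  have h1 : Tendsto (fun n => (f x).toReal + (xs n - x) * η) atTop (𝓝 (f x).toReal) := by
    simpa using ((hlim.sub_const x).mul_const η).const_add (f x).toReal
  have h2 : Tendsto (fun n => (f x).toReal + (xs n - x) * ηs n) atTop (𝓝 (f x).toReal) := by
    simpa using ((hlim.sub_const x).mul hη).const_add (f x).toReal
  refine tendsto_of_tendsto_of_tendsto_of_le_of_le h1 h2 (fun n => ?_) (fun n => ?_)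
  · have := hx.2 _ (hxs n).1
    simp only; linarith
  · have := (hxs n).2 x hx.1
    simp only; linarith

namespace IsGenerator

variable {f : ℝ → EReal} (hf : IsGenerator f)
include hf

theorem argmax_nonempty_isCompact {η : ℝ} (hη : η ∈ conjInterior f) :
    (argmax f η).Nonempty ∧ IsCompact (argmax f η) := by
  obtain ⟨δ, hδ, c, hc⟩ := hη
  -- The slack `δ` bounds `x * δ` by `c` minus the objective at `x`, so beyond `R` the objective is
  -- below its value at `1`. The search reduces to the compact interval `[0, R]`.
  set R : ℝ := max 1 ((c - (1 * η - (f 1).toReal)) / δ) with hR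
  have h1R : (1 : ℝ) ∈ Icc 0 R := ⟨zero_le_one, le_max_left _ _⟩
  have hout : ∀ x ∈ effDom f, R < x → x * η - (f x).toReal < 1 * η - (f 1).toReal := by
    intro x hx hRx
    have h1 : (c - (1 * η - (f 1).toReal)) / δ < x := (le_max_right _ _).trans_lt hRx
    rw [div_lt_iff₀ hδ] at h1
    have := hc x hx
    linarith
  have hcont : ∀ x, ContinuousAt (fun p : EReal × EReal => p.1 + p.2)
      (f x, ((-(x * η) : ℝ) : EReal)) := fun x =>
    EReal.continuousAt_add (Or.inr (EReal.coe_ne_bot _)) (Or.inr (EReal.coe_ne_top _))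
  have hlsc : LowerSemicontinuous fun x => f x + ((-(x * η) : ℝ) : EReal) :=
    hf.lsc.add' (Continuous.lowerSemicontinuous (by
      exact continuous_coe_real_ereal.comp (by fun_prop))) hcont
  obtain ⟨x, hxR, hxmin⟩ := (hlsc.lowerSemicontinuousOn _).exists_isMinOn ⟨1, h1R⟩
    (isCompact_Icc (a := (0 : ℝ)) (b := R))
  have hval : ∀ y ∈ effDom f, f y + ((-(y * η) : ℝ) : EReal) =
      (((f y).toReal - y * η : ℝ) : EReal) := fun y hy => by
    conv_lhs => rw [← hf.coe_toReal hy]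
    rw [← EReal.coe_add, sub_eq_add_neg]
  have hxD : x ∈ effDom f := by
    by_contra hx
    have h1 : f x + ((-(x * η) : ℝ) : EReal) ≤ f 1 + ((-(1 * η) : ℝ) : EReal) := hxmin h1R
    have h2 : f x = ⊤ := by simpa [effDom] using hx
    rw [h2, EReal.top_add_coe, hval 1 hf.one_mem_effDom] at h1
    exact (EReal.coe_lt_top _).not_ge h1
  have hmin : ∀ y ∈ effDom f, y ≤ R → y * η - (f y).toReal ≤ x * η - (f x).toReal := by
    intro y hy hyR
    have h1 : f x + ((-(x * η) : ℝ) : EReal) ≤ f y + ((-(y * η) : ℝ) : EReal) :=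
      hxmin ⟨hf.nonneg_of_mem hy, hyR⟩
    rw [hval x hxD, hval y hy] at h1
    have := EReal.coe_le_coe_iff.1 h1
    linarith
  have hxM : x ∈ argmax f η := by
    refine ⟨hxD, fun y hy => ?_⟩
    rcases le_or_gt y R with h | h
    · exact hmin y hy h
    · exact (hout y hy h).le.trans (hmin 1 hf.one_mem_effDom h1R.2)
  refine ⟨⟨x, hxM⟩, ?_⟩
  have heq : argmax f η = (fun y => f y + ((-(y * η) : ℝ) : EReal)) ⁻¹'
      Iic (((f x).toReal - x * η : ℝ) : EReal) := by
    ext y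
    constructor
    · intro hy
      rw [mem_preimage, hval y hy.1]
      have := hy.2 x hxD
      exact EReal.coe_le_coe_iff.2 (by linarith)
    · intro hy
      rw [mem_preimage, mem_Iic] at hy
      have hyD : y ∈ effDom f := by
        by_contra hc
        have h2 : f y = ⊤ := by simpa [effDom] using hc
        rw [h2, EReal.top_add_coe] at hy
        exact (EReal.coe_lt_top _).not_ge hy
      rw [hval y hyD] at hy
      have := EReal.coe_le_coe_iff.1 hy
      exact ⟨hyD, fun z hz => by linarith [hxM.2 z hz]⟩
  have hclosed : IsClosed (argmax f η) := by
    rw [heq]; exact hlsc.isClosed_preimage _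
  refine (isCompact_Icc (a := (0 : ℝ)) (b := R)).of_isClosed_subset hclosed fun y hy => ?_
  refine ⟨hf.nonneg_of_mem hy.1, ?_⟩
  by_contra hc
  exact (hout y hy.1 (not_le.1 hc)).not_ge (hy.2 1 hf.one_mem_effDom)

theorem selMin_mem {η : ℝ} (hη : η ∈ conjInterior f) : selMin f η ∈ argmax f η := by
  obtain ⟨h1, h2⟩ := hf.argmax_nonempty_isCompact hη
  rw [selMin, if_pos hη]
  exact h2.sInf_mem h1

theorem selMax_mem {η : ℝ} (hη : η ∈ conjInterior f) : selMax f η ∈ argmax f η := by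
  obtain ⟨h1, h2⟩ := hf.argmax_nonempty_isCompact hη
  rw [selMax, if_pos hη]
  exact h2.sSup_mem h1

theorem selMin_le {η x : ℝ} (hη : η ∈ conjInterior f) (hx : x ∈ argmax f η) :
    selMin f η ≤ x := by
  rw [selMin, if_pos hη]
  exact csInf_le (hf.argmax_nonempty_isCompact hη).2.bddBelow hx

theorem le_selMax {η x : ℝ} (hη : η ∈ conjInterior f) (hx : x ∈ argmax f η) :
    x ≤ selMax f η := by
  rw [selMax, if_pos hη]
  exact le_csSup (hf.argmax_nonempty_isCompact hη).2.bddAbove hx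

omit hf in
-- Since `conjInterior f` is a lower set, assigning `⊤` outside it extends the selection to a
-- monotone function on the whole line.
theorem measurable_of_monotone_selection {s : ℝ → ℝ}
    (h : ∀ η ∈ conjInterior f, s η ∈ argmax f η) (h0 : ∀ η ∉ conjInterior f, s η = 0) :
    Measurable s := by
  classical
  set e : ℝ → EReal := fun η => if η ∈ conjInterior f then (s η : EReal) else ⊤ with he
  have hmono : Monotone e := by
    intro a b hab
    by_cases hb : b ∈ conjInterior f
    · have ha := isLowerSet_conjInterior hab hb
      simp only [he, if_pos ha, if_pos hb]
      rcases hab.eq_or_lt with rfl | hlt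
      · exact le_rfl
      · exact EReal.coe_le_coe_iff.2 (argmax_mono hlt (h a ha) (h b hb))
    · simp only [he, if_neg hb]; exact le_top
  convert hmono.measurable.ereal_toReal using 1
  funext η
  by_cases hη : η ∈ conjInterior f
  · simp [he, hη]
  · simp [he, hη, h0 η hη]

theorem measurable_selMin : Measurable (selMin f) :=
  measurable_of_monotone_selection (fun _ => hf.selMin_mem) fun η hη => by rw [selMin, if_neg hη]

/-- By `argmax_mono` the open intervals between the extreme maximizers are pairwise disjoint, and
the line holds only countably many nonempty ones. -/
theorem countable_selMin_ne_selMax : {η | selMin f η ≠ selMax f η}.Countable := by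
  have hU : ∀ η ∈ {η | selMin f η ≠ selMax f η}, η ∈ conjInterior f := by
    intro η hη
    by_contra hc
    exact hη (by rw [selMin, selMax, if_neg hc, if_neg hc])
  have hdisj : ∀ η ∈ {η | selMin f η ≠ selMax f η}, ∀ η' ∈ {η | selMin f η ≠ selMax f η},
      η < η' → Disjoint (Ioo (selMin f η) (selMax f η)) (Ioo (selMin f η') (selMax f η')) := by
    intro η hη η' hη' hlt
    rw [Set.disjoint_left]
    intro z hz hz'
    have := argmax_mono hlt (hf.selMax_mem (hU η hη)) (hf.selMin_mem (hU η' hη'))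
    linarith [hz.2, hz'.1]
  refine Set.PairwiseDisjoint.countable_of_isOpen
    (s := fun η => Ioo (selMin f η) (selMax f η)) ?_ (fun η _ => isOpen_Ioo) ?_
  · intro η hη η' hη' hne
    rcases lt_or_gt_of_ne hne with h | h
    · exact hdisj η hη η' hη' h
    · exact (hdisj η' hη' η hη h).symm
  · intro η hη
    exact nonempty_Ioo.2 (lt_of_le_of_ne (hf.selMin_le (hU η hη) (hf.selMax_mem (hU η hη))) hη)

/-- Points between two maximizers are maximizers. -/
theorem argmax_convex {η : ℝ} : Convex ℝ (argmax f η) := by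
  intro x hx z hz a b ha hb hab
  have h1 := hf.convexOn.2 hx.1 hz.1 ha hb hab
  simp only [smul_eq_mul] at h1
  refine ⟨hf.convexOn.1 hx.1 hz.1 ha hb hab, fun y hy => ?_⟩
  have h2 := mul_le_mul_of_nonneg_left (hx.2 y hy) ha
  have h3 := mul_le_mul_of_nonneg_left (hz.2 y hy) hb
  have h4 : a * (y * η - (f y).toReal) + b * (y * η - (f y).toReal) = y * η - (f y).toReal := by
    rw [← add_mul, hab, one_mul]
  simp only [smul_eq_mul]
  linarith

/-- Moving from a point towards a maximizer does not decrease the objective. -/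
theorem le_of_between {η x0 c x : ℝ} (hx0 : x0 ∈ effDom f) (hx : x ∈ argmax f η)
    (hc : c ∈ segment ℝ x0 x) :
    c ∈ effDom f ∧ x0 * η - (f x0).toReal ≤ c * η - (f c).toReal := by
  obtain ⟨a, b, ha, hb, hab, rfl⟩ := hc
  refine ⟨hf.convexOn.1 hx0 hx.1 ha hb hab, ?_⟩
  have h1 := hf.convexOn.2 hx0 hx.1 ha hb hab
  have h2 := mul_le_mul_of_nonneg_left (hx.2 x0 hx0) hb
  have h4 : a * (x0 * η - (f x0).toReal) + b * (x0 * η - (f x0).toReal) =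
      x0 * η - (f x0).toReal := by
    rw [← add_mul, hab, one_mul]
  simp only [smul_eq_mul] at h1 ⊢
  linarith

/-- If `c` lay between `x0` and a maximizer for `ηs n`, concavity would make it at least as good as
`x0` at slope `ηs n`. At the limit slope `η` it is strictly worse or outside the domain. -/
theorem eventually_not_between {η x0 c : ℝ} (hx0 : x0 ∈ argmax f η) (hc : c ∉ argmax f η)
    {ηs xs : ℕ → ℝ} (hη : Tendsto ηs atTop (𝓝 η)) (hxs : ∀ n, xs n ∈ argmax f (ηs n)) :
    ∀ᶠ n in atTop, c ∉ segment ℝ x0 (xs n) := by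
  by_cases hcD : c ∈ effDom f
  · have hlt : c * η - (f c).toReal < x0 * η - (f x0).toReal := by
      by_contra h
      exact hc ⟨hcD, fun y hy => (hx0.2 y hy).trans (not_lt.1 h)⟩
    have := ((hη.const_mul c).sub_const (f c).toReal).eventually_lt
      ((hη.const_mul x0).sub_const (f x0).toReal) hlt
    filter_upwards [this] with n hn hseg
    exact hn.not_ge (hf.le_of_between hx0.1 (hxs n) hseg).2
  · exact Eventually.of_forall fun n hseg => hcD (hf.le_of_between hx0.1 (hxs n) hseg).1

theorem tendsto_selMax {η : ℝ} (hU : η ∈ conjInterior f) {ηs xs : ℕ → ℝ}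
    (hη : Tendsto ηs atTop (𝓝 η)) (hlt : ∀ n, η < ηs n) (hxs : ∀ n, xs n ∈ argmax f (ηs n)) :
    Tendsto xs atTop (𝓝 (selMax f η)) := by
  have hM := hf.selMax_mem hU
  have hge : ∀ n, selMax f η ≤ xs n := fun n => argmax_mono (hlt n) hM (hxs n)
  rw [tendsto_order]
  refine ⟨fun a ha => Eventually.of_forall fun n => ha.trans_le (hge n), fun c hc => ?_⟩
  filter_upwards [hf.eventually_not_between hM (fun h => hc.not_ge (hf.le_selMax hU h)) hη hxs]
    with n hn
  by_contra h
  exact hn (by rw [segment_eq_Icc (hge n)]; exact ⟨hc.le, not_lt.1 h⟩)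

theorem tendsto_selMin {η : ℝ} (hU : η ∈ conjInterior f) {ηs xs : ℕ → ℝ}
    (hη : Tendsto ηs atTop (𝓝 η)) (hlt : ∀ n, ηs n < η) (hxs : ∀ n, xs n ∈ argmax f (ηs n)) :
    Tendsto xs atTop (𝓝 (selMin f η)) := by
  have hM := hf.selMin_mem hU
  have hge : ∀ n, xs n ≤ selMin f η := fun n => argmax_mono (hlt n) (hxs n) hM
  rw [tendsto_order]
  refine ⟨fun c hc => ?_, fun a ha => Eventually.of_forall fun n => (hge n).trans_lt ha⟩
  filter_upwards [hf.eventually_not_between hM (fun h => hc.not_ge (hf.selMin_le hU h)) hη hxs]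
    with n hn
  by_contra h
  exact hn (by rw [segment_symm, segment_eq_Icc (hge n)]; exact ⟨not_lt.1 h, hc.le⟩)

theorem isSubgradient_of_mem_argmax {x η : ℝ} (hx : x ∈ argmax f η) : IsSubgradient f x η := by
  refine ⟨hx.1, fun y => ?_⟩
  by_cases hy : y ∈ effDom f
  · rw [← hf.coe_toReal hx.1, ← hf.coe_toReal hy, ← EReal.coe_add]
    have := hx.2 y hy
    exact EReal.coe_le_coe_iff.2 (by linarith)
  · have : f y = ⊤ := by simpa [effDom] using hy
    rw [this]; exact le_top

omit hf in
theorem genDeriv_eq_of_mem_argmax {x η : ℝ} (hx : x ∈ argmax f η)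
    (hint : x ∈ interior (effDom f)) (hd : DifferentiableAt ℝ (fun y => (f y).toReal) x) :
    genDeriv f x = η := by
  have hmin : IsLocalMin (fun y => (f y).toReal - y * η) x := by
    filter_upwards [mem_interior_iff_mem_nhds.1 hint] with y hy
    linarith [hx.2 y hy]
  have h1 : HasDerivAt (fun y => (f y).toReal - y * η) (deriv (fun y => (f y).toReal) x - 1 * η) x :=
    hd.hasDerivAt.sub ((hasDerivAt_id x).mul_const η)
  have := hmin.hasDerivAt_eq_zero h1
  unfold genDeriv
  linarith

theorem le_of_differentiableAt {x y : ℝ} (hint : x ∈ interior (effDom f))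
    (hd : DifferentiableAt ℝ (fun y => (f y).toReal) x) (hy : y ∈ effDom f) :
    (f x).toReal + genDeriv f x * (y - x) ≤ (f y).toReal := by
  have hx := interior_subset hint
  rcases lt_trichotomy x y with h | rfl | h
  · have := hf.convexOn.le_slope_of_hasDerivAt hx hy h hd.hasDerivAt
    rw [slope_def_field, le_div_iff₀ (by linarith)] at this
    unfold genDeriv; linarith
  · simp
  · have := hf.convexOn.slope_le_of_hasDerivAt hy hx h hd.hasDerivAt
    rw [slope_def_field, div_le_iff₀ (by linarith)] at this
    unfold genDeriv; linarith

/-- For an essentially smooth generator the subgradients live on the interior of the domain. -/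
theorem mem_interior_of_essentiallySmooth (hs : EssentiallySmooth f) {x η : ℝ}
    (hx : x ∈ argmax f η) : x ∈ interior (effDom f) := by
  by_contra hnot
  have hfr : x ∈ frontier (effDom f) := ⟨subset_closure hx.1, hnot⟩
  have hne1 : x ≠ 1 := fun h => hnot (h ▸ hf.one_mem)
  have hconv : Convex ℝ (interior (effDom f)) := hf.convexOn.1.interior
  have hclos : x ∈ closure (interior (effDom f)) := by
    rw [hf.convexOn.1.closure_interior_eq_closure_of_nonempty_interior ⟨1, hf.one_mem⟩]
    exact subset_closure hx.1
  have : (𝓝[interior (effDom f)] x).NeBot := mem_closure_iff_nhdsWithin_neBot.1 hclos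
  -- At a point `z` strictly between `x` and `1`, convexity traps `f' z` between the subgradient `η`
  -- at `x` and `f' 1`. Blow-up of the derivative at `x` provides a `z` violating this.
  have hbig := (hs.2 x hfr).eventually (eventually_gt_atTop (|η| + |genDeriv f 1|))
  have hnear : ∀ᶠ z in 𝓝[interior (effDom f)] x, |z - x| < |x - 1| := by
    refine nhdsWithin_le_nhds ?_
    have := Metric.ball_mem_nhds x (abs_pos.2 (sub_ne_zero.2 hne1))
    filter_upwards [this] with z hz
    simpa [Real.dist_eq] using hz
  obtain ⟨z, ⟨hz1, hz2⟩, hz3⟩ := ((hbig.and hnear).and self_mem_nhdsWithin).exists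
  have hd := hs.1 z hz3
  have i1 := hf.le_of_differentiableAt hz3 hd hx.1
  have i2 := hf.le_of_differentiableAt hz3 hd hf.one_mem_effDom
  have i3 := hf.le_of_differentiableAt hf.one_mem (hs.1 1 hf.one_mem) (interior_subset hz3)
  have i4 := hx.2 z (interior_subset hz3)
  have a1 := neg_abs_le η
  have a2 := le_abs_self η
  have a3 := neg_abs_le (genDeriv f 1)
  have a4 := le_abs_self (genDeriv f 1)
  refine hz1.not_ge (abs_le.2 ?_)
  rcases lt_or_gt_of_ne hne1 with h | h
  · rw [abs_of_neg (sub_neg.2 h), abs_lt] at hz2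
    have hxz : x < z := by
      by_contra hc
      exact hnot (hconv.ordConnected.out hz3 hf.one_mem ⟨not_lt.1 hc, h.le⟩)
    have h1z : z < 1 := by linarith
    have e1 : η ≤ genDeriv f z := by
      by_contra hc
      nlinarith [mul_pos (sub_pos.2 (not_le.1 hc)) (sub_pos.2 hxz)]
    have e2 : genDeriv f z ≤ genDeriv f 1 := by
      by_contra hc
      nlinarith [mul_pos (sub_pos.2 (not_le.1 hc)) (sub_pos.2 h1z)]
    constructor <;> linarith [abs_nonneg η, abs_nonneg (genDeriv f 1)]
  · rw [abs_of_pos (sub_pos.2 h), abs_lt] at hz2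
    have hxz : z < x := by
      by_contra hc
      exact hnot (hconv.ordConnected.out hf.one_mem hz3 ⟨h.le, not_lt.1 hc⟩)
    have h1z : 1 < z := by linarith
    have e1 : genDeriv f z ≤ η := by
      by_contra hc
      nlinarith [mul_pos (sub_pos.2 (not_le.1 hc)) (sub_pos.2 hxz)]
    have e2 : genDeriv f 1 ≤ genDeriv f z := by
      by_contra hc
      nlinarith [mul_pos (sub_pos.2 (not_le.1 hc)) (sub_pos.2 h1z)]
    constructor <;> linarith [abs_nonneg η, abs_nonneg (genDeriv f 1)]

end IsGenerator

/-! ### Mixed selections of maximizers -/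

/-- Interpolation between the extreme maximizers, with weights prescribed at the countably many
points where they differ. -/
noncomputable def selMix (f : ℝ → EReal) (θ : {η | selMin f η ≠ selMax f η} → ℝ) (η : ℝ) : ℝ :=
  open Classical in
  selMin f η + (if h : selMin f η ≠ selMax f η then θ ⟨η, h⟩ else 0) * (selMax f η - selMin f η)

/-- The weights with values in the unit interval. -/
def unitWeights (f : ℝ → EReal) : Set ({η | selMin f η ≠ selMax f η} → ℝ) :=
  univ.pi fun _ => Icc 0 1

theorem isCompact_unitWeights (f : ℝ → EReal) : IsCompact (unitWeights f) :=
  isCompact_univ_pi fun _ => isCompact_Icc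

theorem convex_unitWeights (f : ℝ → EReal) : Convex ℝ (unitWeights f) :=
  convex_pi fun _ _ => convex_Icc 0 1

theorem continuous_selMix (f : ℝ → EReal) (η : ℝ) : Continuous fun θ => selMix f θ η := by
  unfold selMix
  by_cases h : selMin f η ≠ selMax f η
  · simp only [dif_pos h]
    fun_prop
  · simp only [dif_neg h]
    fun_prop

theorem selMix_combo (f : ℝ → EReal) (θ θ' : {η | selMin f η ≠ selMax f η} → ℝ) {a b : ℝ}
    (hab : a + b = 1) (η : ℝ) :
    selMix f (a • θ + b • θ') η = a * selMix f θ η + b * selMix f θ' η := by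
  have hb : b = 1 - a := by linarith
  unfold selMix
  by_cases h : selMin f η ≠ selMax f η
  · simp only [dif_pos h, Pi.add_apply, Pi.smul_apply, smul_eq_mul, hb]
    ring
  · simp only [dif_neg h, hb]
    ring

/-- Along maximizers the generator is affine. -/
theorem toReal_of_mem_argmax {f : ℝ → EReal} {η x z : ℝ} (hx : x ∈ argmax f η)
    (hz : z ∈ argmax f η) : (f x).toReal = (x - z) * η + (f z).toReal := by
  linarith [hx.2 z hz.1, hz.2 x hx.1]

namespace IsGenerator

variable {f : ℝ → EReal} (hf : IsGenerator f)
include hf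

theorem selMix_mem {θ : {η | selMin f η ≠ selMax f η} → ℝ} (hθ : θ ∈ unitWeights f) {η : ℝ}
    (hη : η ∈ conjInterior f) : selMix f θ η ∈ argmax f η := by
  have h1 := hf.selMin_mem hη
  have h2 := hf.selMax_mem hη
  unfold selMix
  by_cases h : selMin f η ≠ selMax f η
  · simp only [dif_pos h]
    obtain ⟨h3, h4⟩ := hθ ⟨η, h⟩ (mem_univ _)
    have := hf.argmax_convex h1 h2 (sub_nonneg.2 h4) h3 (by ring)
    convert this using 1
    simp only [smul_eq_mul]; ring
  · simp only [dif_neg h]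
    simpa using h1

theorem measurable_selMix (θ : {η | selMin f η ≠ selMax f η} → ℝ) : Measurable (selMix f θ) := by
  have hsub : {η | selMin f η ≠ selMix f θ η} ⊆ {η | selMin f η ≠ selMax f η} := fun η hη h =>
    hη (by simp [selMix, h])
  exact hf.measurable_selMin.measurable_of_countable_ne (hf.countable_selMin_ne_selMax.mono hsub)

theorem scaledConj_eq_of_mem_argmax {lam y x : ℝ} (hlam : 0 < lam)
    (hx : x ∈ argmax f (y / lam)) :
    scaledConj f lam y = ((x * y - lam * (f x).toReal : ℝ) : EReal) := by
  refine le_antisymm ?_ (hf.le_scaledConj hlam.le y hx.1)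
  rw [hf.scaledConj_eq hlam.le]
  refine iSup₂_le fun z hz => EReal.coe_le_coe_iff.2 ?_
  have h := mul_le_mul_of_nonneg_left (hx.2 z hz) hlam.le
  have e : ∀ w : ℝ, lam * (w * (y / lam) - (f w).toReal) = w * y - lam * (f w).toReal := by
    intro w; field_simp
  rwa [e, e] at h

/-! ### First-order optimality of the multipliers -/

variable {Ω : Type*} [MeasurableSpace Ω] {m : Measure Ω} [IsProbabilityMeasure m]

/-- Maximizers for nearby multipliers are dominated by one integrable function. -/
theorem exists_dominating {ρ : ℝ} {ℓ : Ω → ℝ} (hℓ : Integrable ℓ m) {lam mu ε : ℝ} (hε : 0 < ε)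
    (hεl : ε < lam) (hfin : ∀ lam' mu', |lam' - lam| ≤ ε → |mu' - mu| ≤ ε →
      dualLoss f m ρ ℓ lam' mu' < ⊤) :
    ∃ G : Ω → ℝ, Integrable G m ∧ ∀ᵐ ω ∂m, ∀ lam' mu', |lam' - lam| ≤ ε / 2 →
      |mu' - mu| ≤ ε / 2 → (ℓ ω - mu') / lam' ∈ conjInterior f ∧
      ∀ x ∈ argmax f ((ℓ ω - mu') / lam'), |x| ≤ G ω ∧ |(f x).toReal| ≤ G ω := by
  have e1 : |mu - ε - mu| ≤ ε := by rw [show mu - ε - mu = -ε by ring, abs_neg, abs_of_pos hε]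
  obtain ⟨p1, p2, -⟩ := hf.integrable_scaledConj hℓ (lam := lam + ε) (by linarith)
    (hfin (lam + ε) (mu - ε) (by rw [add_sub_cancel_left, abs_of_pos hε]) e1)
  obtain ⟨n1, n2, -⟩ := hf.integrable_scaledConj hℓ (lam := lam - ε) (by linarith)
    (hfin (lam - ε) (mu - ε)
      (by rw [show lam - ε - lam = -ε by ring, abs_neg, abs_of_pos hε]) e1)
  set B1 : Ω → ℝ := fun ω => (scaledConj f (lam + ε) (ℓ ω - (mu - ε))).toReal
  set B2 : Ω → ℝ := fun ω => (scaledConj f (lam - ε) (ℓ ω - (mu - ε))).toReal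
  set k : ℝ := |mu| + ε + (lam + ε) * |(f 1).toReal| with hk
  refine ⟨fun ω => 2 / ε * (|B1 ω| + |B2 ω| + (|ℓ ω| + k)),
    ((p2.abs.add n2.abs).add (hℓ.abs.add (integrable_const k))).const_mul _, ?_⟩
  filter_upwards [p1, n1] with ω h1 h2
  -- Two corners of the box suffice: since `x ≥ 0` the worst `mu'` is `mu - ε`, and the worst `lam'`
  -- is `lam - ε` or `lam + ε` according to the sign of `f x`.
  have hbox : ∀ x ∈ effDom f, ∀ lam' mu', |lam' - lam| ≤ ε → mu - ε ≤ mu' →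
      x * (ℓ ω - mu') - lam' * (f x).toReal ≤ |B1 ω| + |B2 ω| := by
    intro x hx lam' mu' hl hmu
    rw [abs_le] at hl
    have c1 := hf.le_scaledConj (lam := lam + ε) (by linarith) (ℓ ω - (mu - ε)) hx
    have c2 := hf.le_scaledConj (lam := lam - ε) (by linarith) (ℓ ω - (mu - ε)) hx
    rw [← h1] at c1
    rw [← h2] at c2
    have c1 : _ ≤ B1 ω := EReal.coe_le_coe_iff.1 c1
    have c2 : _ ≤ B2 ω := EReal.coe_le_coe_iff.1 c2
    have c3 := mul_le_mul_of_nonneg_left hmu (hf.nonneg_of_mem hx)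
    have d1 := le_abs_self (B1 ω)
    have d2 := le_abs_self (B2 ω)
    have d3 := abs_nonneg (B1 ω)
    have d4 := abs_nonneg (B2 ω)
    rcases le_total 0 (f x).toReal with h0 | h0
    · have := mul_le_mul_of_nonneg_right (show lam - ε ≤ lam' by linarith) h0
      linarith
    · have := mul_le_mul_of_nonpos_right (show lam' ≤ lam + ε by linarith) h0
      linarith
  intro lam' mu' hl hmu
  have hl' := abs_le.1 hl
  have hmu' := abs_le.1 hmu
  have hlam' : 0 < lam' := by linarith
  refine ⟨⟨ε / 2 / lam', by positivity, (|B1 ω| + |B2 ω|) / lam', fun x hx => ?_⟩,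
    fun x hx => ?_⟩
  · have := hbox x hx lam' (mu' - ε / 2) (by linarith) (by linarith)
    rw [le_div_iff₀ hlam']
    refine le_trans (le_of_eq ?_) this
    field_simp
    ring
  · have hlow : -(|ℓ ω| + k) ≤ x * (ℓ ω - mu') - lam' * (f x).toReal := by
      have h := mul_le_mul_of_nonneg_left (hx.2 1 hf.one_mem_effDom) hlam'.le
      have e : ∀ w : ℝ, lam' * (w * ((ℓ ω - mu') / lam') - (f w).toReal) =
          w * (ℓ ω - mu') - lam' * (f w).toReal := by
        intro w; field_simp
      rw [e, e] at h
      have d1 := neg_abs_le (ℓ ω)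
      have d2 := neg_abs_le mu
      have d2' := le_abs_self mu
      have d3 := le_abs_self (f 1).toReal
      have d4 := mul_le_mul_of_nonneg_left d3 hlam'.le
      have d5 := mul_le_mul_of_nonneg_right (show lam' ≤ lam + ε by linarith)
        (abs_nonneg (f 1).toReal)
      linarith
    -- Shifting `mu'` or `lam'` by `ε / 2` changes the objective by `ε / 2` times `x` or `± f x`.
    -- The upper bound `hbox` and the lower bound `hlow`, from the competitor `1`, therefore control
    -- both.
    have b1 := hbox x hx.1 lam' (mu' - ε / 2) (by linarith) (by linarith)
    have b2 := hbox x hx.1 (lam' - ε / 2) mu'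
      (by rw [abs_le]; constructor <;> linarith) (by linarith)
    have b3 := hbox x hx.1 (lam' + ε / 2) mu'
      (by rw [abs_le]; constructor <;> linarith) (by linarith)
    have key : ∀ z : ℝ, ε / 2 * z ≤ |B1 ω| + |B2 ω| + (|ℓ ω| + k) →
        z ≤ 2 / ε * (|B1 ω| + |B2 ω| + (|ℓ ω| + k)) := by
      intro z hz
      calc z = 2 / ε * (ε / 2 * z) := by field_simp
        _ ≤ _ := mul_le_mul_of_nonneg_left hz (by positivity)
    refine ⟨?_, ?_⟩
    · rw [abs_of_nonneg (hf.nonneg_of_mem hx.1)]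
      exact key _ (by linarith)
    · rw [abs_le']
      exact ⟨key _ (by linarith), key _ (by linarith)⟩

/-- First-order optimality of the multipliers, tested against maximizers at perturbed ones. -/
theorem perturbation_nonneg {ρ : ℝ} {ℓ : Ω → ℝ} (hℓ : Integrable ℓ m) {lam mu p q t : ℝ}
    (hlam : 0 < lam) (ht : 0 < t) (hlamt : 0 < lam + t * p)
    (h0 : dualLoss f m ρ ℓ lam mu < ⊤) (h1 : dualLoss f m ρ ℓ (lam + t * p) (mu + t * q) < ⊤)
    (hopt : dualLoss f m ρ ℓ lam mu ≤ dualLoss f m ρ ℓ (lam + t * p) (mu + t * q))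
    {L : Ω → ℝ} (hL : ∀ᵐ ω ∂m, L ω ∈ argmax f ((ℓ ω - (mu + t * q)) / (lam + t * p)))
    (hLi : Integrable L m) (hfi : Integrable (fun ω => (f (L ω)).toReal) m) :
    0 ≤ p * (ρ + (f 1).toReal - ∫ ω, (f (L ω)).toReal ∂m) + q * (1 - ∫ ω, L ω ∂m) := by
  obtain ⟨a1, a2, a3⟩ := hf.integrable_scaledConj hℓ hlam.le h0
  obtain ⟨b1, b2, b3⟩ := hf.integrable_scaledConj hℓ hlamt.le h1
  rw [a3, b3] at hopt
  have hopt := EReal.coe_le_coe_iff.1 hopt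
  have hA : Integrable (fun ω => (t * p) * (f (L ω)).toReal + (t * q) * L ω) m :=
    (hfi.const_mul _).add (hLi.const_mul _)
  -- `L` attains the perturbed supremum and is merely a competitor in the unperturbed one; the two
  -- objectives at `L` differ by a term linear in `t`.
  have hle : ∫ ω, (scaledConj f (lam + t * p) (ℓ ω - (mu + t * q))).toReal ∂m ≤
      ∫ ω, (scaledConj f lam (ℓ ω - mu)).toReal ∂m -
        ((t * p) * ∫ ω, (f (L ω)).toReal ∂m + (t * q) * ∫ ω, L ω ∂m) := by
    rw [← integral_const_mul, ← integral_const_mul,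
      ← integral_add (hfi.const_mul _) (hLi.const_mul _), ← integral_sub a2 hA]
    refine integral_mono_ae b2 (a2.sub hA) ?_
    filter_upwards [a1, hL] with ω h3 h4
    rw [hf.scaledConj_eq_of_mem_argmax hlamt h4, EReal.toReal_coe]
    have := hf.le_scaledConj hlam.le (ℓ ω - mu) h4.1
    rw [← h3] at this
    have := EReal.coe_le_coe_iff.1 this
    linarith
  have : 0 ≤ t * (p * (ρ + (f 1).toReal - ∫ ω, (f (L ω)).toReal ∂m) +
      q * (1 - ∫ ω, L ω ∂m)) := by linarith
  exact nonneg_of_mul_nonneg_right this ht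

omit [IsProbabilityMeasure m] in
/-- The mass and divergence attained by the mixed selections form a compact convex set. -/
theorem isCompact_convex_selMix {ξ : Ω → ℝ} (hξ : Measurable ξ) {G : Ω → ℝ} (hG : Integrable G m)
    (hdom : ∀ᵐ ω ∂m, ξ ω ∈ conjInterior f ∧
      ∀ x ∈ argmax f (ξ ω), |x| ≤ G ω ∧ |(f x).toReal| ≤ G ω) :
    (∀ θ ∈ unitWeights f, Integrable (fun ω => selMix f θ (ξ ω)) m ∧
      Integrable (fun ω => (f (selMix f θ (ξ ω))).toReal) m) ∧
    IsCompact ((fun θ => ((∫ ω, selMix f θ (ξ ω) ∂m, ∫ ω, (f (selMix f θ (ξ ω))).toReal ∂m) :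
      ℝ × ℝ)) '' unitWeights f) ∧
    Convex ℝ ((fun θ => ((∫ ω, selMix f θ (ξ ω) ∂m, ∫ ω, (f (selMix f θ (ξ ω))).toReal ∂m) :
      ℝ × ℝ)) '' unitWeights f) := by
  -- Countability makes the cube of weights first countable, as continuity by dominated convergence
  -- requires.
  have : Countable {η | selMin f η ≠ selMax f η} := hf.countable_selMin_ne_selMax
  have hm1 : ∀ θ, Measurable fun ω => selMix f θ (ξ ω) := fun θ =>
    (hf.measurable_selMix θ).comp hξ
  have hm2 : ∀ θ, Measurable fun ω => (f (selMix f θ (ξ ω))).toReal := fun θ =>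
    hf.measurable_toReal.comp (hm1 θ)
  have hb1 : ∀ θ ∈ unitWeights f, ∀ᵐ ω ∂m, ‖selMix f θ (ξ ω)‖ ≤ G ω := fun θ hθ =>
    hdom.mono fun ω hω => (hω.2 _ (hf.selMix_mem hθ hω.1)).1
  have hb2 : ∀ θ ∈ unitWeights f, ∀ᵐ ω ∂m, ‖(f (selMix f θ (ξ ω))).toReal‖ ≤ G ω := fun θ hθ =>
    hdom.mono fun ω hω => (hω.2 _ (hf.selMix_mem hθ hω.1)).2
  have hi1 : ∀ θ ∈ unitWeights f, Integrable (fun ω => selMix f θ (ξ ω)) m := fun θ hθ =>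
    hG.mono' (hm1 θ).aestronglyMeasurable (hb1 θ hθ)
  have hi2 : ∀ θ ∈ unitWeights f, Integrable (fun ω => (f (selMix f θ (ξ ω))).toReal) m :=
    fun θ hθ => hG.mono' (hm2 θ).aestronglyMeasurable (hb2 θ hθ)
  refine ⟨fun θ hθ => ⟨hi1 θ hθ, hi2 θ hθ⟩, ?_, ?_⟩
  · refine (isCompact_unitWeights f).image_of_continuousOn (ContinuousOn.prodMk ?_ ?_)
    · exact continuousOn_of_dominated (fun θ _ => (hm1 θ).aestronglyMeasurable) hb1 hG
        (ae_of_all _ fun ω => (continuous_selMix f (ξ ω)).continuousOn)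
    · refine continuousOn_of_dominated (fun θ _ => (hm2 θ).aestronglyMeasurable) hb2 hG
        (hdom.mono fun ω hω => ?_)
      -- On the maximizers of one slope `f` is affine, so its value along `selMix` is continuous in
      -- the weights.
      have hc : Continuous fun θ => (selMix f θ (ξ ω) - selMin f (ξ ω)) * ξ ω +
          (f (selMin f (ξ ω))).toReal :=
        (((continuous_selMix f (ξ ω)).sub continuous_const).mul continuous_const).add
          continuous_const
      exact hc.continuousOn.congr fun θ hθ =>
        toReal_of_mem_argmax (hf.selMix_mem hθ hω.1) (hf.selMin_mem hω.1)
  · rintro _ ⟨θ, hθ, rfl⟩ _ ⟨θ', hθ', rfl⟩ a b ha hb hab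
    have hmem := convex_unitWeights f hθ hθ' ha hb hab
    refine ⟨a • θ + b • θ', hmem, ?_⟩
    simp only [Prod.smul_mk, Prod.mk_add_mk, smul_eq_mul]
    refine Prod.ext ?_ ?_
    · simp only
      rw [← integral_const_mul, ← integral_const_mul,
        ← integral_add ((hi1 θ hθ).const_mul a) ((hi1 θ' hθ').const_mul b)]
      exact integral_congr_ae (ae_of_all _ fun ω => selMix_combo f θ θ' hab (ξ ω))
    · simp only
      rw [← integral_const_mul, ← integral_const_mul,
        ← integral_add ((hi2 θ hθ).const_mul a) ((hi2 θ' hθ').const_mul b)]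
      refine integral_congr_ae (hdom.mono fun ω hω => ?_)
      have hz := hf.selMin_mem hω.1
      simp only
      rw [toReal_of_mem_argmax (hf.selMix_mem hmem hω.1) hz,
        toReal_of_mem_argmax (hf.selMix_mem hθ hω.1) hz,
        toReal_of_mem_argmax (hf.selMix_mem hθ' hω.1) hz, selMix_combo f θ θ' hab]
      have hb' : b = 1 - a := by linarith
      rw [hb']; ring

open Classical in
/-- Maximizers at multipliers approaching along a ray converge to an extreme selection. -/
theorem tendsto_selMin_ray {y mu lam p q : ℝ} {t : ℕ → ℝ} (ht : ∀ n, 0 < t n)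
    (ht0 : Tendsto t atTop (𝓝 0)) (hlam : 0 < lam) (hlamt : ∀ n, 0 < lam + t n * p)
    (hU : (y - mu) / lam ∈ conjInterior f)
    (hUn : ∀ n, (y - (mu + t n * q)) / (lam + t n * p) ∈ conjInterior f) :
    Tendsto (fun n => selMin f ((y - (mu + t n * q)) / (lam + t n * p))) atTop
      (𝓝 (selMix f (fun η => if q + p * η < 0 then 1 else 0) ((y - mu) / lam))) := by
  set ξ := (y - mu) / lam with hξ
  -- The sign of `q + p * ξ` decides the side from which the slope `ξ` is approached, hence which
  -- extreme maximizer is the limit. If it vanishes the slope does not move and `selMin` is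
  -- constant, which matches weight `0`.
  have hdiff : ∀ n, (y - (mu + t n * q)) / (lam + t n * p) =
      ξ - t n * (q + p * ξ) / (lam + t n * p) := by
    intro n
    have := (hlamt n).ne'
    rw [eq_sub_iff_add_eq, ← add_div, div_eq_iff this]
    have hy : y = mu + ξ * lam := by rw [hξ]; field_simp; ring
    rw [hy]; ring
  have hlim : Tendsto (fun n => (y - (mu + t n * q)) / (lam + t n * p)) atTop (𝓝 ξ) := by
    have h1 : Tendsto (fun n => y - (mu + t n * q)) atTop (𝓝 (y - mu)) := by
      simpa using ((ht0.mul_const q).const_add mu).const_sub y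
    have h2 : Tendsto (fun n => lam + t n * p) atTop (𝓝 lam) := by
      simpa using (ht0.mul_const p).const_add lam
    exact h1.div h2 hlam.ne'
  have hmem := fun n => hf.selMin_mem (hUn n)
  rcases lt_trichotomy (q + p * ξ) 0 with h | h | h
  · have : selMix f (fun η => if q + p * η < 0 then 1 else 0) ξ = selMax f ξ := by
      unfold selMix
      by_cases hne : selMin f ξ ≠ selMax f ξ
      · simp [h, hne]
      · rw [not_not] at hne
        simp [hne]
    rw [this]
    refine hf.tendsto_selMax hU hlim (fun n => ?_) hmem
    rw [hdiff]
    have := div_neg_of_neg_of_pos (mul_neg_of_pos_of_neg (ht n) h) (hlamt n)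
    linarith
  · have : selMix f (fun η => if q + p * η < 0 then 1 else 0) ξ = selMin f ξ := by
      simp [selMix, h]
    rw [this]
    simp only [hdiff, h, mul_zero, zero_div, sub_zero]
    exact tendsto_const_nhds
  · have : selMix f (fun η => if q + p * η < 0 then 1 else 0) ξ = selMin f ξ := by
      simp [selMix, h.not_gt]
    rw [this]
    refine hf.tendsto_selMin hU hlim (fun n => ?_) hmem
    rw [hdiff]
    have := div_pos (mul_pos (ht n) h) (hlamt n)
    linarith

/-- At optimal multipliers there is a density of maximizers for which both constraints are
active. -/
theorem exists_density {ρ : ℝ} {ℓ : Ω → ℝ} (hm : Measurable ℓ) (hℓ : Integrable ℓ m) {lam mu : ℝ}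
    (hlam : 0 < lam)
    (hfin : ∀ᶠ p : ℝ × ℝ in 𝓝 (lam, mu), dualLoss f m ρ ℓ p.1 p.2 < ⊤)
    (hopt : ∀ lam' mu', 0 ≤ lam' → dualLoss f m ρ ℓ lam mu ≤ dualLoss f m ρ ℓ lam' mu') :
    ∃ L : Ω → ℝ, Measurable L ∧ (∀ ω, 0 ≤ L ω) ∧ Integrable L m ∧ ∫ ω, L ω ∂m = 1 ∧
      (∀ᵐ ω ∂m, L ω ∈ argmax f ((ℓ ω - mu) / lam)) ∧
      Integrable (fun ω => (f (L ω)).toReal) m ∧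
      ∫ ω, (f (L ω)).toReal ∂m = ρ + (f 1).toReal := by
  classical
  obtain ⟨ε, hε, hεl, hbox⟩ : ∃ ε > 0, ε < lam ∧ ∀ lam' mu', |lam' - lam| ≤ ε → |mu' - mu| ≤ ε →
      dualLoss f m ρ ℓ lam' mu' < ⊤ := by
    obtain ⟨r, hr, h⟩ := Metric.eventually_nhds_iff.1 hfin
    refine ⟨min r lam / 2, by positivity, ?_, fun lam' mu' h1 h2 => ?_⟩
    · linarith [min_le_right r lam]
    · refine h (y := (lam', mu')) ?_
      have : min r lam / 2 < r := by linarith [min_le_left r lam]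
      rw [Prod.dist_eq, max_lt_iff, Real.dist_eq, Real.dist_eq]
      exact ⟨h1.trans_lt this, h2.trans_lt this⟩
  obtain ⟨G, hG, hdom⟩ := hf.exists_dominating hℓ hε hεl hbox
  set ξ : Ω → ℝ := fun ω => (ℓ ω - mu) / lam with hξdef
  have hξ : Measurable ξ := (hm.sub_const mu).div_const lam
  have hdom0 : ∀ᵐ ω ∂m, ξ ω ∈ conjInterior f ∧
      ∀ x ∈ argmax f (ξ ω), |x| ≤ G ω ∧ |(f x).toReal| ≤ G ω :=
    hdom.mono fun ω h => h lam mu (by simp; positivity) (by simp; positivity)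
  obtain ⟨hint, hcomp, hconv⟩ := hf.isCompact_convex_selMix hξ hG hdom0
  suffices hmain : ∃ θ ∈ unitWeights f, ∫ ω, selMix f θ (ξ ω) ∂m = 1 ∧
      ∫ ω, (f (selMix f θ (ξ ω))).toReal ∂m = ρ + (f 1).toReal by
    obtain ⟨θ, hθ, h1, h2⟩ := hmain
    have hmem : ∀ᵐ ω ∂m, selMix f θ (ξ ω) ∈ argmax f (ξ ω) :=
      hdom0.mono fun ω hω => hf.selMix_mem hθ hω.1
    have heq : ∀ᵐ ω ∂m, max (selMix f θ (ξ ω)) 0 = selMix f θ (ξ ω) :=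
      hmem.mono fun ω hω => max_eq_left (hf.nonneg_of_mem hω.1)
    obtain ⟨i1, i2⟩ := hint θ hθ
    have heq2 : (fun ω => (f (max (selMix f θ (ξ ω)) 0)).toReal) =ᵐ[m]
        fun ω => (f (selMix f θ (ξ ω))).toReal := heq.mono fun ω hω => by simp only [hω]
    refine ⟨fun ω => max (selMix f θ (ξ ω)) 0,
      ((hf.measurable_selMix θ).comp hξ).max measurable_const, fun ω => le_max_right _ _,
      i1.congr (heq.mono fun ω hω => hω.symm), ?_, ?_, i2.congr heq2.symm, ?_⟩
    · rw [integral_congr_ae heq, h1]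
    · filter_upwards [hmem, heq] with ω h3 h4
      rw [h4]; exact h3
    · rw [integral_congr_ae heq2, h2]
  by_contra hno
  have hz : ((1 : ℝ), ρ + (f 1).toReal) ∉ (fun θ => ((∫ ω, selMix f θ (ξ ω) ∂m,
      ∫ ω, (f (selMix f θ (ξ ω))).toReal ∂m) : ℝ × ℝ)) '' unitWeights f := by
    rintro ⟨θ, hθ, h⟩
    exact hno ⟨θ, hθ, congrArg Prod.fst h, congrArg Prod.snd h⟩
  obtain ⟨φ, u, hu1, hu2⟩ := geometric_hahn_banach_point_closed hconv hcomp.isClosed hz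
  set q := φ (1, 0) with hq
  set p := φ (0, 1) with hp
  have hdec : ∀ a b : ℝ, φ (a, b) = a * q + b * p := by
    intro a b
    have : ((a, b) : ℝ × ℝ) = a • (1, 0) + b • (0, 1) := by simp
    rw [this, map_add, map_smul, map_smul]
    simp [hq, hp]
  -- These are the weights of the selection reached when the multipliers move along `(p, q)`.
  set θ0 : {η | selMin f η ≠ selMax f η} → ℝ := fun η => if q + p * (η : ℝ) < 0 then 1 else 0
    with hθ0
  have hθ0m : θ0 ∈ unitWeights f := by
    intro η _
    simp only [hθ0]
    split_ifs <;> simp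
  have hlt := hu1.trans (hu2 _ ⟨θ0, hθ0m, rfl⟩)
  rw [hdec, hdec] at hlt
  -- Steps up to `τ` keep the ray in the half-size box where `G` dominates all maximizers.
  set τ : ℝ := ε / 2 / (|p| + |q| + 1) with hτ
  have hd : 0 < |p| + |q| + 1 := by positivity
  have hτ0 : 0 < τ := by positivity
  set t : ℕ → ℝ := fun n => τ / ((n : ℝ) + 1) with ht
  have ht0 : ∀ n, 0 < t n := fun n => by positivity
  have htτ : ∀ n, t n ≤ τ := fun n => div_le_self hτ0.le (by
    have : (0 : ℝ) ≤ n := Nat.cast_nonneg n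
    linarith)
  have htlim : Tendsto t atTop (𝓝 0) := by
    simpa [ht, div_eq_mul_inv] using
      (tendsto_one_div_add_atTop_nhds_zero_nat (𝕜 := ℝ)).const_mul τ
  have hbd : ∀ n (s : ℝ), |s| ≤ |p| + |q| + 1 → |t n * s| ≤ ε / 2 := by
    intro n s hs
    rw [abs_mul, abs_of_pos (ht0 n)]
    calc t n * |s| ≤ τ * (|p| + |q| + 1) :=
          mul_le_mul (htτ n) hs (abs_nonneg s) hτ0.le
      _ = ε / 2 := by rw [hτ]; field_simp
  have hbp : ∀ n, |t n * p| ≤ ε / 2 := fun n => hbd n p (by linarith [abs_nonneg q])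
  have hbq : ∀ n, |t n * q| ≤ ε / 2 := fun n => hbd n q (by linarith [abs_nonneg p])
  have hlamt : ∀ n, 0 < lam + t n * p := fun n => by linarith [(abs_le.1 (hbp n)).1]
  have hdomn : ∀ᵐ ω ∂m, ∀ n, (ℓ ω - (mu + t n * q)) / (lam + t n * p) ∈ conjInterior f ∧
      ∀ x ∈ argmax f ((ℓ ω - (mu + t n * q)) / (lam + t n * p)),
        |x| ≤ G ω ∧ |(f x).toReal| ≤ G ω :=
    hdom.mono fun ω h n => h _ _ (by rw [add_sub_cancel_left]; exact hbp n)
      (by rw [add_sub_cancel_left]; exact hbq n)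
  set L : ℕ → Ω → ℝ := fun n ω => selMin f ((ℓ ω - (mu + t n * q)) / (lam + t n * p)) with hL
  have hLm : ∀ n, Measurable (L n) := fun n =>
    hf.measurable_selMin.comp ((hm.sub_const _).div_const _)
  have hfLm : ∀ n, Measurable fun ω => (f (L n ω)).toReal := fun n =>
    hf.measurable_toReal.comp (hLm n)
  have hLmem : ∀ᵐ ω ∂m, ∀ n, L n ω ∈ argmax f ((ℓ ω - (mu + t n * q)) / (lam + t n * p)) :=
    hdomn.mono fun ω h n => hf.selMin_mem (h n).1
  have hLb : ∀ n, ∀ᵐ ω ∂m, ‖L n ω‖ ≤ G ω := fun n => by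
    filter_upwards [hdomn, hLmem] with ω h1 h2 using ((h1 n).2 _ (h2 n)).1
  have hfLb : ∀ n, ∀ᵐ ω ∂m, ‖(f (L n ω)).toReal‖ ≤ G ω := fun n => by
    filter_upwards [hdomn, hLmem] with ω h1 h2 using ((h1 n).2 _ (h2 n)).2
  have hLlim : ∀ᵐ ω ∂m, Tendsto (fun n => L n ω) atTop (𝓝 (selMix f θ0 (ξ ω))) := by
    filter_upwards [hdomn, hdom0] with ω h1 h2
    exact hf.tendsto_selMin_ray ht0 htlim hlam hlamt h2.1 fun n => (h1 n).1
  have hfLlim : ∀ᵐ ω ∂m, Tendsto (fun n => (f (L n ω)).toReal) atTop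
      (𝓝 (f (selMix f θ0 (ξ ω))).toReal) := by
    filter_upwards [hLmem, hdom0, hLlim] with ω h1 h2 h3
    refine tendsto_toReal_argmax (hf.selMix_mem hθ0m h2.1) ?_ h1 h3
    have e1 : Tendsto (fun n => ℓ ω - (mu + t n * q)) atTop (𝓝 (ℓ ω - mu)) := by
      simpa using ((htlim.mul_const q).const_add mu).const_sub (ℓ ω)
    have e2 : Tendsto (fun n => lam + t n * p) atTop (𝓝 lam) := by
      simpa using (htlim.mul_const p).const_add lam
    exact e1.div e2 hlam.ne'
  have I1 := tendsto_integral_of_dominated_convergence G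
    (fun n => (hLm n).aestronglyMeasurable) hG hLb hLlim
  have I2 := tendsto_integral_of_dominated_convergence G
    (fun n => (hfLm n).aestronglyMeasurable) hG hfLb hfLlim
  have hnonneg : ∀ n, 0 ≤ p * (ρ + (f 1).toReal - ∫ ω, (f (L n ω)).toReal ∂m) +
      q * (1 - ∫ ω, L n ω ∂m) := fun n =>
    hf.perturbation_nonneg hℓ hlam (ht0 n) (hlamt n)
      (hbox lam mu (by simp [hε.le]) (by simp [hε.le]))
      (hbox _ _ (by rw [add_sub_cancel_left]; linarith [hbp n])
        (by rw [add_sub_cancel_left]; linarith [hbq n]))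
      (hopt _ _ (hlamt n).le) (hLmem.mono fun ω h => h n)
      (hG.mono' (hLm n).aestronglyMeasurable (hLb n))
      (hG.mono' (hfLm n).aestronglyMeasurable (hfLb n))
  -- In the limit the first-order expression is nonnegative at the selection `θ0`, whereas the
  -- separation `hlt` makes it negative.
  have := ge_of_tendsto (((I2.const_sub (ρ + (f 1).toReal)).const_mul p).add
    ((I1.const_sub 1).const_mul q)) (Eventually.of_forall hnonneg)
  linarith

end IsGenerator

/-! ### Integrable losses and the worst-case measure -/

theorem dualLoss_congr_ae {Ω : Type*} [MeasurableSpace Ω] {m : Measure Ω} (f : ℝ → EReal) (ρ : ℝ)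
    {ℓ ℓ' : Ω → ℝ} (h : ℓ =ᵐ[m] ℓ') (lam mu : ℝ) :
    dualLoss f m ρ ℓ lam mu = dualLoss f m ρ ℓ' lam mu := by
  unfold dualLoss
  congr 1
  exact expect_congr_ae (h.mono fun ω hω => by simp only [hω])

theorem expect_congr_of_ac {Ω : Type*} [MeasurableSpace Ω] {m m' : Measure Ω} (hac : m' ≪ m)
    {ℓ ℓ' : Ω → ℝ} (h : ℓ =ᵐ[m] ℓ') :
    expect m' (fun ω => (ℓ ω : EReal)) = expect m' (fun ω => (ℓ' ω : EReal)) :=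
  expect_congr_ae ((hac.ae_eq h).mono fun ω hω => by simp only [hω])

theorem worstLoss_congr_ae {Ω : Type*} [MeasurableSpace Ω] {m : Measure Ω} (f : ℝ → EReal) (ρ : ℝ)
    {ℓ ℓ' : Ω → ℝ} (h : ℓ =ᵐ[m] ℓ') : worstLoss f m ρ ℓ = worstLoss f m ρ ℓ' :=
  iSup_congr fun _ => iSup_congr fun hm' => expect_congr_of_ac hm'.2.1 h

namespace IsGenerator

variable {f : ℝ → EReal} (hf : IsGenerator f)
include hf

variable {Ω : Type*} [MeasurableSpace Ω] {m : Measure Ω} [IsProbabilityMeasure m]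

/-- Both sides see the loss only up to `m`-null sets, because the measures in the ball are
absolutely continuous. A measurable representative may be used. -/
theorem worstLoss_eq_iInf_dualLoss {ρ : ℝ} (hρ : 0 < ρ) {ℓ : Ω → ℝ} (hℓ : Integrable ℓ m) :
    worstLoss f m ρ ℓ = ⨅ lam : ℝ, ⨅ _ : 0 ≤ lam, ⨅ mu : ℝ, dualLoss f m ρ ℓ lam mu := by
  have hae := hℓ.aemeasurable.ae_eq_mk
  rw [worstLoss_congr_ae f ρ hae,
    hf.worstLoss_eq hρ hℓ.aemeasurable.measurable_mk (hℓ.congr hae)]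
  simp only [dualLoss_congr_ae f ρ hae]

/-- Optimal multipliers of positive weight give a worst-case density. -/
theorem exists_worst_density {ρ : ℝ} {ℓ : Ω → ℝ} (hℓ : Integrable ℓ m) {lam mu : ℝ}
    (hlam : 0 < lam)
    (hfin : ∀ᶠ p : ℝ × ℝ in 𝓝 (lam, mu), dualLoss f m ρ ℓ p.1 p.2 < ⊤)
    (hopt : ∀ lam' mu', 0 ≤ lam' → dualLoss f m ρ ℓ lam mu ≤ dualLoss f m ρ ℓ lam' mu') :
    ∃ L : Ω → ℝ, Measurable L ∧ (∀ ω, 0 ≤ L ω) ∧ Integrable L m ∧ ∫ ω, L ω ∂m = 1 ∧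
      (∀ᵐ ω ∂m, L ω ∈ argmax f ((ℓ ω - mu) / lam)) ∧
      m.withDensity (fun ω => ENNReal.ofReal (L ω)) ∈ ball f m ρ ∧
      expect (m.withDensity (fun ω => ENNReal.ofReal (L ω))) (fun ω => (ℓ ω : EReal)) =
        worstLoss f m ρ ℓ := by
  have hae := hℓ.aemeasurable.ae_eq_mk
  obtain ⟨L, hLm, hL0, hLi, hL1, hLM, hfi, hfρ⟩ :=
    hf.exists_density (ρ := ρ) hℓ.aemeasurable.measurable_mk (hℓ.congr hae) hlam
      (by simpa only [dualLoss_congr_ae f ρ hae] using hfin)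
      (by simpa only [dualLoss_congr_ae f ρ hae] using hopt)
  have hLM : ∀ᵐ ω ∂m, L ω ∈ argmax f ((ℓ ω - mu) / lam) := by
    filter_upwards [hLM, hae] with ω h1 h2
    rw [h2]; exact h1
  have hball := hf.withDensity_mem_ball hL0 hLi hL1 (hLM.mono fun ω h => h.1) hfi hfρ.le
  refine ⟨L, hLm, hL0, hLi, hL1, hLM, hball, le_antisymm ?_ ?_⟩
  · exact le_iSup₂ (f := fun m' (_ : m' ∈ ball f m ρ) => expect m' (fun ω => (ℓ ω : EReal))) _ hball
  obtain ⟨a1, a2, a3⟩ := hf.integrable_scaledConj hℓ hlam.le hfin.self_of_nhds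
  -- Equality in Fenchel's inequality. It makes `L * ℓ` integrable and, with both constraints
  -- active, its integral equal to the dual objective, which bounds the worst-case loss.
  have hval : ∀ᵐ ω ∂m, (scaledConj f lam (ℓ ω - mu)).toReal + lam * (f (L ω)).toReal + mu * L ω =
      L ω * ℓ ω := by
    filter_upwards [hLM] with ω h
    rw [hf.scaledConj_eq_of_mem_argmax hlam h, EReal.toReal_coe]
    ring
  have hA : Integrable (fun ω => (scaledConj f lam (ℓ ω - mu)).toReal +
      lam * (f (L ω)).toReal) m := a2.add (hfi.const_mul lam)
  have hB : Integrable (fun ω => (scaledConj f lam (ℓ ω - mu)).toReal +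
      lam * (f (L ω)).toReal + mu * L ω) m := hA.add (hLi.const_mul mu)
  rw [expect_withDensity_ofReal hL0 hLi (hB.congr hval)]
  refine (hf.worstLoss_le_dualLoss hℓ hlam.le (mu := mu)).trans (le_of_eq ?_)
  rw [a3, ← integral_congr_ae hval, integral_add hA (hLi.const_mul mu),
    integral_add a2 (hfi.const_mul lam), integral_const_mul, integral_const_mul, hfρ, hL1]
  congr 1
  ring

end IsGenerator

end DRGame

/-! ### The duality theorem for the player's problem -/

theorem mainTheorem2 {Ω : Type*} [MeasurableSpace Ω] (m : Measure Ω) [IsProbabilityMeasure m]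
    (f : ℝ → EReal) (hf : DRGame.IsGenerator f)
    (ρ : ℝ) (hρ : 0 < ρ)
    {J : Type*} [DecidableEq J] {E : J → Type*} (A : ∀ i, Set (E i))
    (l : J → (∀ i, E i) → Ω → ℝ) (j : J) (a : ∀ i, E i)
    (hl : ∀ x ∈ A j, Integrable (l j (Function.update a j x)) m) :
    DRGame.robustValue f m ρ A l j a = DRGame.dualValue f m ρ A l j a ∧
    ∀ (x : E j) (lam mu : ℝ), DRGame.SolvesDual f m ρ A l j a x lam mu →
      DRGame.IsRobustBestResponse f m ρ A l j a x ∧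
      (0 < lam →
        (∀ᶠ p : ℝ × ℝ in 𝓝 (lam, mu),
          DRGame.dualLoss f m ρ (l j (Function.update a j x)) p.1 p.2 < ⊤) →
        ∃ L : Ω → ℝ, Measurable L ∧ (∀ ω, 0 ≤ L ω) ∧ Integrable L m ∧ ∫ ω, L ω ∂m = 1 ∧
          (∀ᵐ ω ∂m, L ω ∈ interior (DRGame.effDom f) →
            DifferentiableAt ℝ (fun y => (f y).toReal) (L ω) →
            DRGame.genDeriv f (L ω) = (l j (Function.update a j x) ω - mu) / lam) ∧
          (∀ᵐ ω ∂m, DRGame.IsSubgradient f (L ω)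
            ((l j (Function.update a j x) ω - mu) / lam)) ∧
          (DRGame.EssentiallySmooth f → ∀ᵐ ω ∂m, L ω ∈ interior (DRGame.effDom f) ∧
            DRGame.genDeriv f (L ω) = (l j (Function.update a j x) ω - mu) / lam) ∧
          DRGame.SolvesRobust f m ρ A l j a x
            (m.withDensity (fun ω => ENNReal.ofReal (L ω)))) := by
  have hvalue : DRGame.robustValue f m ρ A l j a = DRGame.dualValue f m ρ A l j a :=
    iInf_congr fun x => iInf_congr fun hx => hf.worstLoss_eq_iInf_dualLoss hρ (hl x hx)
  refine ⟨hvalue, fun x lam mu ⟨hx, hlam, hsol⟩ => ?_⟩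
  have hbest : DRGame.IsRobustBestResponse f m ρ A l j a x := by
    refine ⟨hx, le_antisymm ?_ (iInf₂_le x hx)⟩
    rw [hvalue, ← hsol]
    exact hf.worstLoss_le_dualLoss (hl x hx) hlam
  refine ⟨hbest, fun hpos hfin => ?_⟩
  obtain ⟨L, hLm, hL0, hLi, hL1, hLM, hball, hworst⟩ :=
    hf.exists_worst_density (hl x hx) hpos hfin fun lam' mu' hlam' => by
      rw [hsol]
      exact (iInf₂_le x hx).trans (iInf_le_of_le lam' (iInf_le_of_le hlam' (iInf_le _ mu')))
  refine ⟨L, hLm, hL0, hLi, hL1, ?_, ?_, fun hs => ?_, hbest, hball, hworst⟩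
  · exact hLM.mono fun ω h hi hd => DRGame.IsGenerator.genDeriv_eq_of_mem_argmax h hi hd
  · exact hLM.mono fun ω h => hf.isSubgradient_of_mem_argmax h
  · filter_upwards [hLM] with ω h
    have hi := hf.mem_interior_of_essentiallySmooth hs h
    exact ⟨hi, DRGame.IsGenerator.genDeriv_eq_of_mem_argmax h hi (hs.1 _ hi)⟩
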